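/- Consider the billiard in the unit square $S=[-1/2,1/2]^2$ with one obstacle $O$. Here $O$ is a compact connected set with connected complement and smooth ($C^\infty$) boundary (that is, a smooth closed topological disk, not necessarily convex) contained in the interior of $S$. A trajectory piece of length $T$ is a curve $\gamma:[0,T]\to S\setminus\operatorname{int}O$ consisting of finitely many straight segments, traversed with unit speed, which is reflected by the usual law (angle of incidence equals angle of reflection) at the sides of $S$ and at the boundary of $O$ (a tangency to $\partial O$ leaves the velocity unchanged), and whose velocity is reversed at the vertices of $S$. Fix a point $z$ in the interior of $O$. The displacement along $\gamma$ is the increment of $\frac{1}{2\pi}\arg(\gamma(t)-z)$ over $[0,T]$, for a continuous branch of the argument along $\gamma$. The rotation set $R$ is the set of all limits $\lim_{n\to\infty} d_n/t_n$, where for each $n$ there is a trajectory piece of length $t_n>0$ with displacement $d_n$, and $t_n\to\infty$. Then: 1. $R\subseteq[-\sqrt2/4,\sqrt2/4]$. 2. If, in addition, $O$ is convex and small, that is, contained in a closed ball of radius smaller than $\sqrt2/4$ centered at the center $0$ of the square, then $R=[-\sqrt2/4,\sqrt2/4]$. -/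

import Mathlib

open Set Filter Topology
open scoped ContDiff

noncomputable section

namespace SquareBilliard

/-- The Euclidean plane. -/
abbrev Plane : Type := EuclideanSpace ℝ (Fin 2)

/-- The unit square `[-1/2, 1/2]²`. -/
def square : Set Plane := {x | ∀ i, |x i| ≤ 1 / 2}

/-- `g` is a smooth function that describes `O` near its boundary point `x` as `{g ≤ 0}`,
with non-vanishing gradient at `x`. The gradient of `g` at `x` is then an outer normal to `O`. -/
structure IsDefiningFunctionAt (O : Set Plane) (x : Plane) (g : Plane → ℝ) : Prop where
  contDiff : ContDiff ℝ ∞ g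
  eq_zero : g x = 0
  gradient_ne_zero : gradient g x ≠ 0
  mem_iff : ∀ᶠ y in 𝓝 x, y ∈ O ↔ g y ≤ 0

/-- An obstacle: a compact connected region with connected complement and smooth boundary
(that is, a smooth closed topological disk) in the interior of the unit square.
Convexity is not required. -/
structure IsObstacle (O : Set Plane) : Prop where
  isCompact : IsCompact O
  isConnected : IsConnected O
  isConnected_compl : IsConnected Oᶜ
  subset_interior_square : O ⊆ interior square
  smooth_boundary : ∀ x ∈ frontier O, ∃ g, IsDefiningFunctionAt O x g

/-- A small obstacle: contained in a closed ball of radius smaller than `√2/4` centered at `0`. -/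
def IsSmall (O : Set Plane) : Prop := ∃ r < √2 / 4, O ⊆ Metric.closedBall (0 : Plane) r

/-- The billiard table: the square without the interior of the obstacle. -/
def table (O : Set Plane) : Set Plane := square \ interior O

/-- The law relating the velocity `v` just before and the velocity `w` just after the passage
through the point `x` of the table. Off the obstacle, the `i`-th component of the velocity is
reversed when `x` lies on a side of the square perpendicular to the `i`-th axis (so `w = -v` at a
vertex, and `w = v` at an interior point). On the boundary of the obstacle, `v` is reflected in
the line tangent to the obstacle (so `w = v` if `v` is tangent to it). -/
def VelocityLaw (O : Set Plane) (x v w : Plane) : Prop :=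
  (x ∉ O ∧ ∀ i, w i = if |x i| = 1 / 2 then - v i else v i) ∨
  (x ∈ O ∧ ∃ g, IsDefiningFunctionAt O x g ∧ w = (ℝ ∙ gradient g x)ᗮ.reflection v)

/-- Right after time `t`, the curve `γ` moves along a straight line with velocity `v`. -/
def HasVelocityAfter (γ : ℝ → Plane) (t : ℝ) (v : Plane) : Prop :=
  ∃ ε > 0, ∀ s ∈ Icc 0 ε, γ (t + s) = γ t + s • v

/-- Right before time `t`, the curve `γ` moves along a straight line with velocity `v`. -/
def HasVelocityBefore (γ : ℝ → Plane) (t : ℝ) (v : Plane) : Prop :=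
  ∃ ε > 0, ∀ s ∈ Icc 0 ε, γ (t - s) = γ t - s • v

/-- The restriction of `γ` to `[0, T]` is a piece of length `T` of a billiard trajectory, moving
with unit speed. (By compactness of `[0, T]` it is made of finitely many straight segments.) -/
structure IsTrajectoryPiece (O : Set Plane) (T : ℝ) (γ : ℝ → Plane) : Prop where
  pos : 0 < T
  mem_table : ∀ t ∈ Icc 0 T, γ t ∈ table O
  velocity_start : ∃ w : Plane, ‖w‖ = 1 ∧ HasVelocityAfter γ 0 w
  velocity_end : ∃ v : Plane, ‖v‖ = 1 ∧ HasVelocityBefore γ T v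
  velocity_law : ∀ t ∈ Ioo 0 T, ∃ v w : Plane, ‖v‖ = 1 ∧ ‖w‖ = 1 ∧
    HasVelocityBefore γ t v ∧ HasVelocityAfter γ t w ∧ VelocityLaw O (γ t) v w

/-- `d` is the displacement along `γ` on `[0, T]`: the increment of `arg (γ t - z) / (2 * π)`,
computed with a continuous branch `φ` of this function along the curve. -/
def IsDisplacement (z : Plane) (γ : ℝ → Plane) (T d : ℝ) : Prop :=
  ∃ φ : ℝ → ℝ, ContinuousOn φ (Icc 0 T) ∧
    (∀ t ∈ Icc 0 T, γ t - z =
      ‖γ t - z‖ • (!₂[Real.cos (2 * Real.pi * φ t), Real.sin (2 * Real.pi * φ t)] : Plane)) ∧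
    d = φ T - φ 0

/-- The rotation set of the billiard in the square with obstacle `O`, rotation being measured
around the point `z`: all limits of the ratios (displacement / length) along sequences of
trajectory pieces whose lengths go to infinity. -/
def rotationSet (O : Set Plane) (z : Plane) : Set ℝ :=
  {ρ | ∃ (γ : ℕ → ℝ → Plane) (T d : ℕ → ℝ),
    (∀ n, IsTrajectoryPiece O (T n) (γ n) ∧ IsDisplacement z (γ n) (T n) (d n)) ∧
    Tendsto T atTop atTop ∧ Tendsto (fun n => d n / T n) atTop (𝓝 ρ)}

end SquareBilliard

end

namespace SquareBilliard

open scoped RealInnerProductSpace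

/-! ### Local structure of the boundary of an obstacle -/

/-! Upper bound. Fix a coordinate direction, say the horizontal one, and let `A` and `B` be a
leftmost and a rightmost point of `O`. A curve that turns around `O` crosses alternately the
horizontal ray going left from `A` and the one going right from `B`. Beyond the extreme points of
`O` only the wall can reverse the horizontal velocity, so between a visit to the right, one to the
left and another to the right the curve touches the left wall; symmetrically on the other side
(`IsTrajectoryPiece.exists_coord_eq_neg_half`). Up to a bounded error, each turn therefore costs
horizontal variation 2, and likewise vertical variation 2 (`two_mul_sub_le_variation`). At unit
speed the two variations add up to at most `√2 * T`, because `|v 0| + |v 1| ≤ √2`. Hence `4 * |d| ≤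
√2 * T + C`.

The crossings are counted with arguments about interior points near `A` and `B`, whereas the
displacement refers to `z`. Since `O` is a connected smooth region, the difference of the arguments
about two interior points is a continuous function off the interior of `O` (`IsObstacle.angleRel`),
hence bounded on the table. Convexity plays no role here.

Lower bound. Unfold the square: trajectories become motions in the plane among reflected copies of
`O`, one around each lattice point, separated because `O` is small. Start at the midpoint of the
lower side with direction `θ`. For `θ = π / 4` and `θ = 3 * π / 4` the line misses all copies and
folds to the diamond through the midpoints of the sides, run through in the two senses: one turn per
length `2 * √2`. For convex `O` the position at a given time depends continuously on `θ`, although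
the velocity does not (`continuous_iterate_next_pos`). So the displacement over the length `2 * √2 *
n` is continuous in `θ`, at least `n` at one end and at most `-n` at the other. By the intermediate
value theorem it takes the value `ρ * (2 * √2 * n)` for every `|ρ| ≤ √2 / 4`
(`exists_trajectory_of_speed`).

Continuity is obtained by cutting time into steps of length `τ`, so short that at most one
reflection per step has to be recorded. The relation `Step` is closed and determines the next state
up to a reflection of the velocity at the boundary; compactness does the rest. -/

theorem eventually_neg_of_hasDerivAt {φ : ℝ → ℝ} {a : ℝ} (h : HasDerivAt φ a 0) (h0 : φ 0 = 0)
    (ha : a < 0) : ∀ᶠ t in 𝓝[>] (0 : ℝ), φ t < 0 := by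
  have h1 := (hasDerivAt_iff_tendsto_slope.1 h).eventually (gt_mem_nhds ha)
  have h2 : 𝓝[>] (0 : ℝ) ≤ 𝓝[≠] 0 := nhdsWithin_mono _ fun x hx => ne_of_gt hx
  filter_upwards [h2 h1, self_mem_nhdsWithin] with t ht htpos
  rw [slope_def_field, h0, sub_zero, sub_zero] at ht
  have htpos : 0 < t := htpos
  by_contra hcon
  exact absurd ht (not_lt.2 (div_nonneg (not_lt.1 hcon) htpos.le))

theorem tendsto_add_smul {E : Type*} [NormedAddCommGroup E] [NormedSpace ℝ E] (x u : E) :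
    Tendsto (fun t : ℝ => x + t • u) (𝓝[>] 0) (𝓝 x) := by
  have : Continuous fun t : ℝ => x + t • u := by fun_prop
  have h := this.tendsto 0
  simp only [zero_smul, add_zero] at h
  exact h.mono_left nhdsWithin_le_nhds

namespace IsDefiningFunctionAt

variable {O : Set Plane} {x u : Plane} {g : Plane → ℝ}

theorem hasDerivAt (hg : IsDefiningFunctionAt O x g) (u : Plane) :
    HasDerivAt (fun t : ℝ => g (x + t • u)) ⟪gradient g x, u⟫ 0 := by
  have hd : DifferentiableAt ℝ g x :=
    (hg.contDiff.differentiable (by simp)).differentiableAt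
  have h1 : HasFDerivAt g (InnerProductSpace.toDual ℝ Plane (gradient g x)) (x + (0 : ℝ) • u) := by
    simpa using hd.hasGradientAt.hasFDerivAt
  have h2 : HasDerivAt (fun t : ℝ => x + t • u) u 0 := by
    simpa using ((hasDerivAt_id (0 : ℝ)).smul_const u).const_add x
  exact h1.comp_hasDerivAt (0 : ℝ) h2

theorem eventually_mem_interior (hg : IsDefiningFunctionAt O x g) (hu : ⟪gradient g x, u⟫ < 0) :
    ∀ᶠ t in 𝓝[>] (0 : ℝ), x + t • u ∈ interior O := by
  have h1 := eventually_neg_of_hasDerivAt (hg.hasDerivAt u) (by simpa using hg.eq_zero) hu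
  have h2 := (tendsto_add_smul x u).eventually hg.mem_iff.eventually_nhds
  filter_upwards [h1, h2] with t ht1 ht2
  rw [mem_interior_iff_mem_nhds]
  have h3 : ∀ᶠ y in 𝓝 (x + t • u), g y < 0 :=
    hg.contDiff.continuous.continuousAt.eventually (gt_mem_nhds ht1)
  filter_upwards [ht2, h3] with y hy1 hy2
  exact hy1.2 hy2.le

theorem eventually_notMem (hg : IsDefiningFunctionAt O x g) (hu : 0 < ⟪gradient g x, u⟫) :
    ∀ᶠ t in 𝓝[>] (0 : ℝ), x + t • u ∉ O := by
  have h1 := eventually_neg_of_hasDerivAt (hg.hasDerivAt u).neg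
    (by simpa using hg.eq_zero) (neg_lt_zero.2 hu)
  have h2 := (tendsto_add_smul x u).eventually hg.mem_iff
  filter_upwards [h1, h2] with t ht1 ht2 ht
  have := ht2.1 ht
  simp only [Pi.neg_apply] at ht1
  linarith

theorem mem (hg : IsDefiningFunctionAt O x g) : x ∈ O := hg.mem_iff.self_of_nhds.2 hg.eq_zero.le

theorem notMem_interior (hg : IsDefiningFunctionAt O x g) : x ∉ interior O := by
  intro hx
  have h1 : 0 < ⟪gradient g x, gradient g x⟫ :=
    real_inner_self_pos.2 hg.gradient_ne_zero
  have h2 := (tendsto_add_smul x (gradient g x)).eventually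
    (isOpen_interior.mem_nhds hx)
  obtain ⟨t, ht1, ht2⟩ := ((hg.eventually_notMem h1).and h2).exists
  exact ht1 (interior_subset ht2)

end IsDefiningFunctionAt

/-- A linear functional that is non-positive on an open half-space is a multiple of the functional
defining the half-space. -/
theorem exists_eq_smul_of_halfSpace {E : Type*} [NormedAddCommGroup E] [InnerProductSpace ℝ E]
    {g n : E} (hg : g ≠ 0) (h : ∀ u, ⟪g, u⟫ < 0 → ⟪n, u⟫ ≤ 0) : ∃ c : ℝ, 0 ≤ c ∧ n = c • g := by
  have hgg : 0 < ⟪g, g⟫ := real_inner_self_pos.2 hg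
  set c := ⟪n, g⟫ / ⟪g, g⟫ with hc
  have hcg : ⟪n, g⟫ = c * ⟪g, g⟫ := by rw [hc]; field_simp
  have hc0 : 0 ≤ c := by
    have := h (-g) (by rw [inner_neg_right]; linarith)
    rw [inner_neg_right] at this
    exact div_nonneg (by linarith) hgg.le
  refine ⟨c, hc0, ?_⟩
  set w := n - c • g with hw
  have hgw : ⟪g, w⟫ = 0 := by
    rw [hw, inner_sub_right, inner_smul_right, real_inner_comm, hcg, sub_self]
  have hnw : ⟪n, w⟫ = ⟪w, w⟫ := by
    have : n = w + c • g := by simp [hw]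
    nth_rewrite 1 [this]
    rw [inner_add_left, inner_smul_left, hgw]; simp
  -- The vector `w` only lies on the boundary of the half-space; subtracting a small multiple of `g`
  -- moves it inside, at a cost below `ε`.
  have key : ∀ ε > (0 : ℝ), ⟪w, w⟫ ≤ ε := by
    intro ε hε
    have hpos : 0 < c * ⟪g, g⟫ + 1 := by positivity
    have := h (w - (ε / (c * ⟪g, g⟫ + 1)) • g) (by
      rw [inner_sub_right, inner_smul_right, hgw]
      have : 0 < ε / (c * ⟪g, g⟫ + 1) * ⟪g, g⟫ := by positivity
      linarith)
    rw [inner_sub_right, inner_smul_right, hnw, hcg] at this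
    have h2 : ε / (c * ⟪g, g⟫ + 1) * (c * ⟪g, g⟫) ≤ ε := by
      rw [div_mul_eq_mul_div, div_le_iff₀ hpos]; nlinarith
    linarith
  have h0 : ⟪w, w⟫ = 0 := le_antisymm (le_of_forall_pos_le_add (by simpa using key))
    real_inner_self_nonneg
  have : w = 0 := inner_self_eq_zero.1 h0
  rw [hw] at this
  exact sub_eq_zero.1 this

/-- `n` is a nonzero outer normal of a half-plane that contains `O` and is bounded by a line
through the point `a` of `O`. -/
structure IsNormal (O : Set Plane) (a n : Plane) : Prop where
  mem : a ∈ O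
  ne_zero : n ≠ 0
  inner_le : ∀ y ∈ O, ⟪n, y - a⟫ ≤ 0

namespace IsNormal

variable {O : Set Plane} {a n u y : Plane}

theorem inner_lt (h : IsNormal O a n) (hy : y ∈ interior O) : ⟪n, y - a⟫ < 0 := by
  have h2 := (tendsto_add_smul y n).eventually (isOpen_interior.mem_nhds hy)
  obtain ⟨t, ht1, ht2⟩ := (h2.and self_mem_nhdsWithin).exists
  have ht2 : 0 < t := ht2
  have h3 := h.inner_le _ (interior_subset ht1)
  rw [add_sub_right_comm, inner_add_right, inner_smul_right] at h3
  have h4 : 0 < t * ⟪n, n⟫ := mul_pos ht2 (real_inner_self_pos.2 h.ne_zero)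
  linarith

theorem notMem_interior (h : IsNormal O a n) : a ∉ interior O := fun ha => by
  simpa using h.inner_lt ha

theorem mem_frontier (h : IsNormal O a n) : a ∈ frontier O :=
  ⟨subset_closure h.mem, h.notMem_interior⟩

/-- Directions with negative inner product with the gradient enter `O`, hence point into the
supporting half-plane; two nested half-planes through the same point coincide. -/
theorem exists_eq_smul_gradient {g : Plane → ℝ} (h : IsNormal O a n)
    (hg : IsDefiningFunctionAt O a g) : ∃ c : ℝ, 0 < c ∧ n = c • gradient g a := by
  obtain ⟨c, hc, hn⟩ := exists_eq_smul_of_halfSpace (n := n) hg.gradient_ne_zero fun u hu => by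
    obtain ⟨t, ht1, ht2⟩ := ((hg.eventually_mem_interior hu).and self_mem_nhdsWithin).exists
    have ht2 : 0 < t := ht2
    have h3 := h.inner_lt ht1
    rw [add_sub_cancel_left, inner_smul_right] at h3
    exact (neg_of_mul_neg_right h3 ht2.le).le
  refine ⟨c, lt_of_le_of_ne hc fun h0 => h.ne_zero ?_, hn⟩
  rw [hn, ← h0, zero_smul]

theorem eventually_mem_interior (h : IsNormal O a n)
    (hO : ∀ x ∈ frontier O, ∃ g, IsDefiningFunctionAt O x g) (hu : ⟪n, u⟫ < 0) :
    ∀ᶠ t in 𝓝[>] (0 : ℝ), a + t • u ∈ interior O := by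
  obtain ⟨g, hg⟩ := hO a h.mem_frontier
  obtain ⟨c, hc, hn⟩ := h.exists_eq_smul_gradient hg
  apply hg.eventually_mem_interior
  rw [hn, real_inner_smul_left] at hu
  exact neg_of_mul_neg_right hu hc.le

end IsNormal

/-! ### Basic properties of trajectory pieces -/

namespace HasVelocityAfter

variable {γ : ℝ → Plane} {t : ℝ} {v : Plane}

theorem hasDerivWithinAt (h : HasVelocityAfter γ t v) : HasDerivWithinAt γ v (Ici t) t := by
  obtain ⟨ε, hε, h⟩ := h
  have h1 : HasDerivWithinAt (fun s => γ t + (s - t) • v) v (Ici t) t := by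
    simpa using (((hasDerivWithinAt_id t (Ici t)).sub_const t).smul_const v).const_add (γ t)
  refine h1.congr_of_eventuallyEq ?_ (by simp)
  filter_upwards [Icc_mem_nhdsGE (show t < t + ε by linarith)] with s hs
  have := h (s - t) ⟨by linarith [hs.1], by linarith [hs.2]⟩
  simpa using this

end HasVelocityAfter

namespace HasVelocityBefore

variable {γ : ℝ → Plane} {t : ℝ} {v : Plane}

theorem hasDerivWithinAt (h : HasVelocityBefore γ t v) : HasDerivWithinAt γ v (Iic t) t := by
  obtain ⟨ε, hε, h⟩ := h
  have h1 : HasDerivWithinAt (fun s => γ t + (s - t) • v) v (Iic t) t := by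
    simpa using (((hasDerivWithinAt_id t (Iic t)).sub_const t).smul_const v).const_add (γ t)
  refine h1.congr_of_eventuallyEq ?_ (by simp)
  filter_upwards [Icc_mem_nhdsLE (show t - ε < t by linarith)] with s hs
  have := h (t - s) ⟨by linarith [hs.2], by linarith [hs.1]⟩
  rw [sub_sub_cancel] at this
  rw [this, sub_eq_add_neg, ← neg_smul]
  simp

end HasVelocityBefore

namespace IsTrajectoryPiece

variable {O : Set Plane} {T : ℝ} {γ : ℝ → Plane}

theorem exists_velocityAfter (h : IsTrajectoryPiece O T γ) {t : ℝ} (ht : t ∈ Ico 0 T) :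
    ∃ w : Plane, ‖w‖ = 1 ∧ HasVelocityAfter γ t w := by
  rcases ht.1.eq_or_lt with rfl | h0
  · exact h.velocity_start
  · obtain ⟨v, w, -, hw, -, hw', -⟩ := h.velocity_law t ⟨h0, ht.2⟩
    exact ⟨w, hw, hw'⟩

theorem exists_velocityBefore (h : IsTrajectoryPiece O T γ) {t : ℝ} (ht : t ∈ Ioc 0 T) :
    ∃ w : Plane, ‖w‖ = 1 ∧ HasVelocityBefore γ t w := by
  rcases ht.2.eq_or_lt with rfl | h0
  · exact h.velocity_end
  · obtain ⟨v, w, hv, -, hv', -, -⟩ := h.velocity_law t ⟨ht.1, h0⟩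
    exact ⟨v, hv, hv'⟩

theorem continuousOn (h : IsTrajectoryPiece O T γ) : ContinuousOn γ (Icc 0 T) := by
  intro t ht
  have h1 : ContinuousWithinAt γ (Icc t T) t := by
    rcases ht.2.eq_or_lt with rfl | h0
    · simp
    · obtain ⟨w, -, hw⟩ := h.exists_velocityAfter ⟨ht.1, h0⟩
      exact hw.hasDerivWithinAt.continuousWithinAt.mono Icc_subset_Ici_self
  have h2 : ContinuousWithinAt γ (Icc 0 t) t := by
    rcases ht.1.eq_or_lt with rfl | h0
    · simp
    · obtain ⟨w, -, hw⟩ := h.exists_velocityBefore ⟨h0, ht.2⟩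
      exact hw.hasDerivWithinAt.continuousWithinAt.mono Icc_subset_Iic_self
  rw [← Icc_union_Icc_eq_Icc ht.1 ht.2]
  exact h2.union h1

theorem norm_sub_le (h : IsTrajectoryPiece O T γ) {s t : ℝ} (hs : 0 ≤ s) (hst : s ≤ t)
    (ht : t ≤ T) : ‖γ t - γ s‖ ≤ t - s := by
  choose w hw hw' using fun (x : ℝ) (hx : x ∈ Ico 0 T) => h.exists_velocityAfter hx
  classical
  have := norm_image_sub_le_of_norm_deriv_right_le_segment (f := γ) (a := s) (b := t) (C := 1)
    (f' := fun x => if hx : x ∈ Ico 0 T then w x hx else 0)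
    (h.continuousOn.mono (Icc_subset_Icc hs ht))
    (fun x hx => by
      have hx' : x ∈ Ico 0 T := ⟨hs.trans hx.1, hx.2.trans_le ht⟩
      simp only [hx', dif_pos]
      exact (hw' x hx').hasDerivWithinAt)
    (fun x hx => by
      have hx' : x ∈ Ico 0 T := ⟨hs.trans hx.1, hx.2.trans_le ht⟩
      simp only [hx', dif_pos]
      exact (hw x hx').le) t ⟨hst, le_rfl⟩
  simpa using this

theorem notMem_interior (h : IsTrajectoryPiece O T γ) {t : ℝ} (ht : t ∈ Icc 0 T) :
    γ t ∉ interior O := (h.mem_table t ht).2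

end IsTrajectoryPiece

/-! ### A trajectory that passes beyond the obstacle touches the side of the square -/

/-- Consider the first minimum of the coordinate: the velocity component is negative before it and
not after it. Off the obstacle only the wall does this. On the obstacle the point would be extreme,
with normal along the axis, and the curve would have come through the interior. The sign `σ` covers
both opposite sides. -/
theorem IsTrajectoryPiece.exists_coord_eq_neg_half {O : Set Plane} {T : ℝ} {γ : ℝ → Plane}
    (h : IsTrajectoryPiece O T γ) (hO : ∀ x ∈ frontier O, ∃ g, IsDefiningFunctionAt O x g)
    {i : Fin 2} {σ : ℝ} (hσ : σ = 1 ∨ σ = -1) {A : Plane}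
    (hA : ∀ y ∈ O, σ * A i ≤ σ * y i) {t₁ s t₂ : ℝ} (h0 : 0 ≤ t₁) (h1 : t₁ < s) (h2 : s < t₂)
    (hT : t₂ ≤ T) (hX1 : σ * A i < σ * γ t₁ i) (hX : σ * γ s i ≤ σ * A i)
    (hX2 : σ * A i < σ * γ t₂ i) : ∃ t ∈ Ioo t₁ t₂, σ * γ t i = -(1 / 2) := by
  set X : ℝ → ℝ := fun t => σ * γ t i with hXdef
  have hsub : Icc t₁ t₂ ⊆ Icc 0 T := Icc_subset_Icc h0 hT
  have hcont : ContinuousOn X (Icc t₁ t₂) := by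
    have : Continuous fun p : Plane => σ * p i := by fun_prop
    exact this.comp_continuousOn (h.continuousOn.mono hsub)
  obtain ⟨m, hm, hmin⟩ := isCompact_Icc.exists_isMinOn (nonempty_Icc.2 (h1.trans h2).le) hcont
  have hμ : X m ≤ σ * A i := (hmin ⟨h1.le, h2.le⟩).trans hX
  have hK : IsCompact (Icc t₁ t₂ ∩ X ⁻¹' Iic (X m)) :=
    isCompact_Icc.of_isClosed_subset
      (hcont.preimage_isClosed_of_isClosed isClosed_Icc isClosed_Iic) inter_subset_left
  -- Taking the earliest minimum makes the coordinate strictly larger beforehand, so the incoming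
  -- velocity component is strictly negative.
  obtain ⟨r, ⟨hr, hrm⟩, hleast⟩ := hK.exists_isLeast ⟨m, hm, le_refl (X m)⟩
  have hrm : X r = X m := le_antisymm hrm (hmin hr)
  have hr1 : t₁ < r := lt_of_le_of_ne hr.1 fun h' => by
    have : X t₁ ≤ σ * A i := by rw [h', hrm]; exact hμ
    exact absurd hX1 (not_lt.2 this)
  have hr2 : r < t₂ := lt_of_le_of_ne hr.2 fun h' => by
    have : X t₂ ≤ σ * A i := by rw [← h', hrm]; exact hμ
    exact absurd hX2 (not_lt.2 this)
  have hlt : ∀ t ∈ Ico t₁ r, X r < X t := fun t ht => by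
    have htI : t ∈ Icc t₁ t₂ := ⟨ht.1, (ht.2.trans hr2).le⟩
    by_contra hcon
    exact absurd (hleast ⟨htI, by simpa [hrm] using hcon⟩) (not_le.2 ht.2)
  refine ⟨r, ⟨hr1, hr2⟩, ?_⟩
  obtain ⟨v, w, -, -, ⟨ε, hε, hv⟩, ⟨ε', hε', hw⟩, hlaw⟩ :=
    h.velocity_law r ⟨h0.trans_lt hr1, hr2.trans_le hT⟩
  have hv0 : σ * v i < 0 := by
    have hpos : 0 < min ε (r - t₁) := lt_min hε (by linarith)
    have e1 := hv (min ε (r - t₁)) ⟨hpos.le, min_le_left _ _⟩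
    have e2 := hlt (r - min ε (r - t₁)) ⟨by linarith [min_le_right ε (r - t₁)], by linarith⟩
    simp only [hXdef, e1, PiLp.sub_apply, PiLp.smul_apply, smul_eq_mul] at e2
    by_contra hcon
    have := mul_nonneg hpos.le (not_lt.1 hcon)
    linarith
  have hw0 : 0 ≤ σ * w i := by
    have hpos : 0 < min ε' (t₂ - r) := lt_min hε' (by linarith)
    have e1 := hw (min ε' (t₂ - r)) ⟨hpos.le, min_le_left _ _⟩
    have e2 : X r ≤ X (r + min ε' (t₂ - r)) := by
      rw [hrm]; exact hmin ⟨by linarith, by linarith [min_le_right ε' (t₂ - r)]⟩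
    simp only [hXdef, e1, PiLp.add_apply, PiLp.smul_apply, smul_eq_mul] at e2
    by_contra hcon
    have := mul_neg_of_pos_of_neg hpos (not_le.1 hcon)
    linarith
  rcases hlaw with ⟨-, hlaw⟩ | ⟨hmem, -⟩
  · have hi := hlaw i
    split_ifs at hi with hc
    · have hle := (h.mem_table t₁ (hsub ⟨le_rfl, (h1.trans h2).le⟩)).1 i
      have hlt' := hlt t₁ ⟨le_rfl, hr1⟩
      have hle' := abs_le.1 hle
      simp only [hXdef] at hlt' ⊢
      rcases hσ with rfl | rfl <;> rcases (abs_eq (by norm_num)).1 hc with h' | h' <;>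
        rw [h'] at hlt' ⊢ <;> linarith
    · rw [hi] at hw0; linarith
  · have hn : IsNormal O (γ r) (EuclideanSpace.single i (-σ)) := by
      refine ⟨hmem, ?_, fun y hy => ?_⟩
      · rcases hσ with rfl | rfl <;> simp
      · have := hA y hy
        have h3 : X r ≤ σ * y i := by rw [hrm]; exact hμ.trans this
        simp only [hXdef] at h3
        simp [EuclideanSpace.inner_single_left]; linarith
    -- Followed backwards, the incoming segment has direction `-v`, which enters the interior of
    -- `O`.
    have hin := hn.eventually_mem_interior (u := -v) hO (by
      simp [EuclideanSpace.inner_single_left]; exact hv0)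
    have hpos : 0 < min ε r := lt_min hε (h0.trans_lt hr1)
    obtain ⟨t, ht, ht'⟩ := (hin.and (Ioo_mem_nhdsGT hpos)).exists
    refine absurd ht ?_
    have e1 := hv t ⟨ht'.1.le, ht'.2.le.trans (min_le_left _ _)⟩
    rw [smul_neg, ← sub_eq_add_neg, ← e1]
    exact h.notMem_interior ⟨by linarith [ht'.2, min_le_right ε r], by
      linarith [ht'.1, hr.2]⟩

/-! ### Angles -/

/-- The plane as the complex numbers. -/
def toComplex (p : Plane) : ℂ := ⟨p 0, p 1⟩

@[simp] theorem toComplex_re (p : Plane) : (toComplex p).re = p 0 := rfl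

@[simp] theorem toComplex_im (p : Plane) : (toComplex p).im = p 1 := rfl

theorem toComplex_sub (p q : Plane) : toComplex (p - q) = toComplex p - toComplex q := by
  apply Complex.ext <;> simp

theorem continuous_toComplex : Continuous toComplex := by
  have : toComplex = fun p : Plane => ((p 0 : ℝ) : ℂ) + (p 1 : ℝ) * Complex.I := by
    funext p; apply Complex.ext <;> simp
  rw [this]; fun_prop

theorem norm_toComplex (p : Plane) : ‖toComplex p‖ = ‖p‖ := by
  rw [Complex.norm_eq_sqrt_sq_add_sq, EuclideanSpace.norm_eq]
  simp

theorem toComplex_injective : Function.Injective toComplex := fun p q h => by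
  have h0 := congrArg Complex.re h
  have h1 := congrArg Complex.im h
  ext i; fin_cases i
  · exact h0
  · exact h1

theorem toComplex_ne_zero {p : Plane} (hp : p ≠ 0) : toComplex p ≠ 0 := by
  rw [← norm_ne_zero_iff, norm_toComplex]; exact norm_ne_zero_iff.2 hp

/-- `θ`, measured in turns, is an argument of the vector `p`. -/
def HasAngle (p : Plane) (θ : ℝ) : Prop :=
  p = ‖p‖ • (!₂[Real.cos (2 * Real.pi * θ), Real.sin (2 * Real.pi * θ)] : Plane)

/-- The point of the unit circle with argument `θ` turns. -/
noncomputable def turn (θ : ℝ) : ℂ := Complex.exp ((2 * Real.pi * θ : ℝ) * Complex.I)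

theorem turn_add (a b : ℝ) : turn (a + b) = turn a * turn b := by
  rw [turn, turn, turn, ← Complex.exp_add]; congr 1; push_cast; ring

theorem hasAngle_iff {p : Plane} {θ : ℝ} : HasAngle p θ ↔ toComplex p = ‖p‖ * turn θ := by
  have hre : ((‖p‖ : ℂ) * turn θ).re = ‖p‖ * Real.cos (2 * Real.pi * θ) := by
    rw [Complex.re_ofReal_mul, turn, Complex.exp_ofReal_mul_I_re]
  have him : ((‖p‖ : ℂ) * turn θ).im = ‖p‖ * Real.sin (2 * Real.pi * θ) := by
    rw [Complex.im_ofReal_mul, turn, Complex.exp_ofReal_mul_I_im]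
  rw [Complex.ext_iff, hre, him, HasAngle]
  constructor
  · intro h
    have h0 := congrArg (fun q : Plane => q 0) h
    have h1 := congrArg (fun q : Plane => q 1) h
    exact ⟨by simpa using h0, by simpa using h1⟩
  · rintro ⟨h0, h1⟩
    ext i; fin_cases i
    · simpa using h0
    · simpa using h1

theorem turn_arg {w : ℂ} : (‖w‖ : ℂ) * turn (Complex.arg w / (2 * Real.pi)) = w := by
  have h : 2 * Real.pi * (Complex.arg w / (2 * Real.pi)) = Complex.arg w := by
    field_simp
  rw [turn, h, Complex.norm_mul_exp_arg_mul_I]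

/-- If `p = q * w` as complex numbers then arguments of `p` and `q` differ by that of `w`. -/
theorem hasAngle_iff_of_mul {p q : Plane} {w : ℂ} (hw : w ≠ 0)
    (h : toComplex p = toComplex q * w) (θ : ℝ) :
    HasAngle p θ ↔ HasAngle q (θ - Complex.arg w / (2 * Real.pi)) := by
  have hn : (‖p‖ : ℂ) = ‖q‖ * ‖w‖ := by
    rw [← norm_toComplex p, h, norm_mul, norm_toComplex]; push_cast; rfl
  have hsplit : turn θ = turn (θ - Complex.arg w / (2 * Real.pi)) *
      turn (Complex.arg w / (2 * Real.pi)) := by rw [← turn_add]; congr 1; ring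
  have hw' : (‖w‖ : ℂ) * turn θ = turn (θ - Complex.arg w / (2 * Real.pi)) * w := by
    rw [hsplit, mul_left_comm, turn_arg]
  rw [hasAngle_iff, hasAngle_iff, h, hn, mul_assoc, hw', ← mul_assoc]
  exact mul_left_inj' hw

/-- There is a continuous function on the complement of the interior of `O` that tells the
difference of the arguments of `p - a` and `p - b`. -/
def AngleRel (O : Set Plane) (a b : Plane) : Prop :=
  ∃ h : Plane → ℝ, ContinuousOn h (interior O)ᶜ ∧
    ∀ p ∉ interior O, ∀ θ, HasAngle (p - a) θ ↔ HasAngle (p - b) (θ - h p)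

namespace AngleRel

variable {O : Set Plane} {a b c : Plane}

theorem symm (h : AngleRel O a b) : AngleRel O b a := by
  obtain ⟨f, hf, hf'⟩ := h
  refine ⟨fun p => - f p, hf.neg, fun p hp θ => ?_⟩
  have := hf' p hp (θ + f p)
  rw [add_sub_cancel_right] at this
  rw [sub_neg_eq_add]; exact this.symm

theorem trans (h : AngleRel O a b) (h' : AngleRel O b c) : AngleRel O a c := by
  obtain ⟨f, hf, hf'⟩ := h
  obtain ⟨g, hg, hg'⟩ := h'
  refine ⟨fun p => f p + g p, hf.add hg, fun p hp θ => ?_⟩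
  rw [hf' p hp θ, hg' p hp, sub_sub]

/-- The quotient `(p - a) / (p - b)` is a non-positive real only if `p` lies on the segment from `a`
to `b`. Off the segment the principal argument of the quotient is therefore continuous. -/
theorem of_segment_subset (h : segment ℝ a b ⊆ interior O) : AngleRel O a b := by
  have hne : ∀ c ∈ segment ℝ a b, ∀ p ∉ interior O, p - c ≠ 0 := fun c hc p hp h0 =>
    hp (by rw [sub_eq_zero.1 h0]; exact h hc)
  have ha := hne a (left_mem_segment ℝ a b)
  have hb := hne b (right_mem_segment ℝ a b)
  refine ⟨fun p => Complex.arg (toComplex (p - a) / toComplex (p - b)) / (2 * Real.pi),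
    fun p hp => ?_, fun p hp θ => ?_⟩
  · have hslit : toComplex (p - a) / toComplex (p - b) ∈ Complex.slitPlane := by
      rw [Complex.mem_slitPlane_iff_not_le_zero, Complex.nonpos_iff]
      rintro ⟨hre, him⟩
      set w := toComplex (p - a) / toComplex (p - b) with hw
      have hww : w = (w.re : ℂ) := Complex.ext (by simp) (by simp [him])
      have heq : toComplex (p - a) = w.re * toComplex (p - b) := by
        rw [← hww, hw, div_mul_cancel₀ _ (toComplex_ne_zero (hb p hp))]
      set τ := -w.re with hτ
      have hτ0 : 0 ≤ τ := by linarith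
      have heq' : p - a = -τ • (p - b) := toComplex_injective <| by
        rw [heq]; apply Complex.ext <;> simp [hτ]
      refine hp (h ?_)
      rw [mem_segment_iff_sameRay]
      have : b - p = -(p - b) := by abel
      rw [heq', this, neg_smul, ← smul_neg]
      exact SameRay.sameRay_nonneg_smul_left _ hτ0
    refine ContinuousAt.continuousWithinAt (ContinuousAt.div_const ?_ _)
    refine ContinuousAt.comp (g := Complex.arg) (Complex.continuousAt_arg hslit) ?_
    refine ContinuousAt.div ?_ ?_ (toComplex_ne_zero (hb p hp))
    · exact (continuous_toComplex.comp (continuous_id.sub continuous_const)).continuousAt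
    · exact (continuous_toComplex.comp (continuous_id.sub continuous_const)).continuousAt
  · refine hasAngle_iff_of_mul
      (div_ne_zero (toComplex_ne_zero (ha p hp)) (toComplex_ne_zero (hb p hp))) ?_ θ
    rw [mul_div_cancel₀ _ (toComplex_ne_zero (hb p hp))]

end AngleRel

/-! ### Connectedness of the interior of an obstacle -/

/-- Near `x` the function `g` strictly decreases along `-G`. Both points can be pushed inwards by `η
• (-G)` along segments inside `O`, and end in a small ball on which `g < 0`, where a segment joins
them. -/
theorem IsDefiningFunctionAt.exists_nhds_angleRel {O : Set Plane} {x : Plane} {g : Plane → ℝ}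
    (hg : IsDefiningFunctionAt O x g) :
    ∃ U ∈ 𝓝 x, ∀ a ∈ U, a ∈ interior O → ∀ b ∈ U, b ∈ interior O → AngleRel O a b := by
  set G := gradient g x with hG
  have hGpos : 0 < ⟪G, G⟫ := real_inner_self_pos.2 hg.gradient_ne_zero
  have hdiff : Differentiable ℝ g := hg.contDiff.differentiable (by simp)
  have hcont : Continuous fun y => fderiv ℝ g y G :=
    (hg.contDiff.continuous_fderiv (by simp)).clm_apply continuous_const
  have hfx : fderiv ℝ g x G = ⟪G, G⟫ := by
    have h1 : fderiv ℝ g x = InnerProductSpace.toDual ℝ Plane G :=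
      hdiff.differentiableAt.hasGradientAt.hasFDerivAt.fderiv
    rw [h1, InnerProductSpace.toDual_apply_apply]
  have hev : ∀ᶠ y in 𝓝 x, (y ∈ O ↔ g y ≤ 0) ∧ 0 < fderiv ℝ g y G :=
    hg.mem_iff.and (hcont.continuousAt.eventually (lt_mem_nhds (hGpos.trans_eq hfx.symm)))
  obtain ⟨r, hr, hball⟩ := Metric.eventually_nhds_iff_ball.1 hev
  have hint : ∀ y ∈ Metric.ball x r, g y < 0 → y ∈ interior O := fun y hy hgy => by
    rw [mem_interior_iff_mem_nhds]
    filter_upwards [Metric.isOpen_ball.mem_nhds hy,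
      hg.contDiff.continuous.continuousAt.eventually (gt_mem_nhds hgy)] with z hz hz'
    exact (hball z hz).1.2 hz'.le
  have hGn : 0 < ‖G‖ := norm_pos_iff.2 hg.gradient_ne_zero
  set η := r / (4 * ‖G‖) with hη
  have hη0 : 0 < η := by positivity
  have hηG : η * ‖G‖ = r / 4 := by rw [hη]; field_simp
  have hmove : ∀ a ∈ Metric.ball x (r / 2), ∀ t ∈ Icc 0 η, a + t • (-G) ∈ Metric.ball x r := by
    intro a ha t ht
    rw [Metric.mem_ball, dist_eq_norm] at ha ⊢
    have h1 : a + t • (-G) - x = (a - x) + t • (-G) := by abel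
    have h2 : ‖t • (-G)‖ ≤ r / 4 := by
      rw [norm_smul, norm_neg, Real.norm_of_nonneg ht.1, ← hηG]
      exact mul_le_mul_of_nonneg_right ht.2 hGn.le
    rw [h1]
    linarith [norm_add_le (a - x) (t • (-G))]
  have hanti : ∀ a ∈ Metric.ball x (r / 2),
      StrictAntiOn (fun t : ℝ => g (a + t • (-G))) (Icc 0 η) := by
    intro a ha
    refine strictAntiOn_of_deriv_neg (convex_Icc 0 η) ?_ fun t ht => ?_
    · exact (hg.contDiff.continuous.comp (by fun_prop)).continuousOn
    · rw [interior_Icc] at ht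
      have h2 : HasDerivAt (fun t : ℝ => a + t • (-G)) (-G) t := by
        simpa using ((hasDerivAt_id t).smul_const (-G)).const_add a
      have h3 := (hdiff (a + t • (-G))).hasFDerivAt.comp_hasDerivAt t h2
      have h4 : deriv (fun t : ℝ => g (a + t • (-G))) t = fderiv ℝ g (a + t • (-G)) (-G) :=
        h3.deriv
      rw [h4, map_neg]
      linarith [(hball _ (hmove a ha t ⟨ht.1.le, ht.2.le⟩)).2]
  have hzero : (0 : ℝ) ∈ Icc 0 η := ⟨le_rfl, hη0.le⟩
  have hneg : ∀ a ∈ Metric.ball x (r / 2), g a ≤ 0 → ∀ t ∈ Ioc 0 η, g (a + t • (-G)) < 0 := by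
    intro a ha hga t ht
    have := hanti a ha hzero ⟨ht.1.le, ht.2⟩ ht.1
    simp only [zero_smul, add_zero] at this
    linarith
  have hx2 : x ∈ Metric.ball x (r / 2) := Metric.mem_ball_self (by positivity)
  have hdeep := hneg x hx2 hg.eq_zero.le η ⟨hη0, le_rfl⟩
  obtain ⟨δ, hδ, hδball⟩ := Metric.eventually_nhds_iff_ball.1
    (hg.contDiff.continuous.continuousAt.eventually (gt_mem_nhds hdeep))
  set δ' := min δ (r / 2) with hδ'
  have hδ'0 : 0 < δ' := lt_min hδ (by positivity)
  have hsub : Metric.ball x δ' ⊆ Metric.ball x (r / 2) :=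
    Metric.ball_subset_ball (min_le_right _ _)
  have hA : ∀ a ∈ Metric.ball x δ', a ∈ interior O → AngleRel O a (a + η • (-G)) := by
    intro a ha haO
    refine AngleRel.of_segment_subset ?_
    rw [segment_eq_image']
    rintro _ ⟨t, ht, rfl⟩
    simp only [add_sub_cancel_left, smul_smul]
    rcases ht.1.eq_or_lt with rfl | ht0
    · simpa using haO
    · have hmem : t * η ∈ Ioc 0 η := ⟨by positivity, by nlinarith [ht.2]⟩
      exact hint _ (hmove a (hsub ha) _ ⟨hmem.1.le, hmem.2⟩)
        (hneg a (hsub ha) ((hball a (Metric.ball_subset_ball (by linarith) (hsub ha))).1.1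
          (interior_subset haO)) _ hmem)
  refine ⟨Metric.ball x δ', Metric.ball_mem_nhds x hδ'0, fun a ha haO b hb hbO => ?_⟩
  refine (hA a ha haO).trans (AngleRel.trans ?_ (hA b hb hbO).symm)
  refine AngleRel.of_segment_subset fun y hy => ?_
  have hconv := convex_ball (x + η • (-G)) δ'
  have htrans : ∀ c ∈ Metric.ball x δ', c + η • (-G) ∈ Metric.ball (x + η • (-G)) δ' := by
    intro c hc
    rw [Metric.mem_ball, dist_add_right]; exact hc
  have hy' := hconv.segment_subset (htrans a ha) (htrans b hb) hy
  have hyx : y ∈ Metric.ball x r := by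
    have h1 : y - η • (-G) ∈ Metric.ball x (r / 2) := hsub (by
      rw [Metric.mem_ball, dist_eq_norm] at hy' ⊢
      rwa [sub_sub, add_comm, ])
    simpa using hmove _ h1 η ⟨hη0.le, le_rfl⟩
  exact hint y hyx (hδball y (Metric.ball_subset_ball (min_le_left _ _) hy'))

theorem IsObstacle.mem_closure_interior {O : Set Plane} (hO : IsObstacle O) {x : Plane}
    (hx : x ∈ O) : x ∈ closure (interior O) := by
  by_cases hxi : x ∈ interior O
  · exact subset_closure hxi
  · obtain ⟨g, hg⟩ := hO.smooth_boundary x ⟨subset_closure hx, hxi⟩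
    have h := hg.eventually_mem_interior (u := - gradient g x) (by
      rw [inner_neg_right]
      exact neg_lt_zero.2 (real_inner_self_pos.2 hg.gradient_ne_zero))
    exact mem_closure_of_tendsto (tendsto_add_smul x _) h

/-- Chaining takes place over the connected set `O`, with the relation required between interior
points near the two given points. Links can be composed because every neighbourhood of a point of
`O` meets the interior. -/
theorem IsObstacle.angleRel {O : Set Plane} (hO : IsObstacle O) {a b : Plane}
    (ha : a ∈ interior O) (hb : b ∈ interior O) : AngleRel O a b := by
  have hloc : ∀ x ∈ O, ∃ U ∈ 𝓝 x,
      ∀ a ∈ U, a ∈ interior O → ∀ b ∈ U, b ∈ interior O → AngleRel O a b := by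
    intro x hx
    by_cases hxi : x ∈ interior O
    · obtain ⟨r, hr, hball⟩ := Metric.isOpen_iff.1 isOpen_interior x hxi
      exact ⟨_, Metric.ball_mem_nhds x hr, fun a ha _ b hb _ =>
        AngleRel.of_segment_subset (((convex_ball x r).segment_subset ha hb).trans hball)⟩
    · obtain ⟨g, hg⟩ := hO.smooth_boundary x ⟨subset_closure hx, hxi⟩
      exact hg.exists_nhds_angleRel
  have key := hO.isConnected.isPreconnected.induction₂
    (P := fun x y => ∃ U ∈ 𝓝 x, ∃ V ∈ 𝓝 y,
      ∀ a ∈ U, a ∈ interior O → ∀ b ∈ V, b ∈ interior O → AngleRel O a b)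
    (fun x hx => by
      obtain ⟨U, hU, h⟩ := hloc x hx
      refine mem_nhdsWithin_of_mem_nhds ?_
      filter_upwards [eventually_mem_nhds_iff.2 hU] with y hy
      exact ⟨U, hU, U, hy, h⟩)
    (fun x y z _ hy _ => by
      rintro ⟨U, hU, V, hV, h1⟩ ⟨V', hV', W, hW, h2⟩
      obtain ⟨c, hc, hc'⟩ := mem_closure_iff_nhds.1 (hO.mem_closure_interior hy) _
        (inter_mem hV hV')
      exact ⟨U, hU, W, hW, fun a ha ha' b hb hb' =>
        (h1 a ha ha' c hc.1 hc').trans (h2 c hc.2 hc' b hb hb')⟩)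
    (fun x y _ _ => by
      rintro ⟨U, hU, V, hV, h⟩
      exact ⟨V, hV, U, hU, fun a ha ha' b hb hb' => (h b hb hb' a ha ha').symm⟩)
    (interior_subset ha) (interior_subset hb)
  obtain ⟨U, hU, V, hV, h⟩ := key
  exact h a (mem_of_mem_nhds hU) ha b (mem_of_mem_nhds hV) hb

/-! ### Counting alternations -/

section Counting

variable {f g X V : ℝ → ℝ} {T lo hi : ℝ}

/-- Here `f` and `g` are the arguments about the left and the right base point. At half-integers
they differ by less than `1/2`, so between two consecutive half-integer levels of `f` the function
`g` passes the integer in between, and the curve is then to the right of `hi`. -/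
theorem exists_lt_lt_of_level (hf : ContinuousOn f (Icc 0 T)) (hg : ContinuousOn g (Icc 0 T))
    (hfX : ∀ t ∈ Icc 0 T, ∀ m : ℤ, f t = m + 1 / 2 → X t ≤ lo ∧ |g t - f t| < 1 / 2)
    (hgX : ∀ t ∈ Icc 0 T, ∀ m : ℤ, g t = m → hi ≤ X t) {s : ℝ} (hs : s ∈ Icc 0 T) {m : ℤ}
    (h0 : f 0 ≤ m + 1 / 2) (hm : f s = (m + 1 : ℤ) + 1 / 2) :
    ∃ s₀ r, 0 ≤ s₀ ∧ s₀ < r ∧ r < s ∧ f s₀ = m + 1 / 2 ∧ hi ≤ X r := by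
  have hle : (m : ℝ) + 1 / 2 ≤ f s := by rw [hm]; push_cast; linarith
  obtain ⟨s₀, hs₀, hfs₀⟩ := intermediate_value_Icc hs.1
    (hf.mono (Icc_subset_Icc_right hs.2)) ⟨h0, hle⟩
  have hs₀T : s₀ ∈ Icc 0 T := ⟨hs₀.1, hs₀.2.trans hs.2⟩
  have h1 := abs_lt.1 (hfX s₀ hs₀T m hfs₀).2
  have h2 := abs_lt.1 (hfX s hs _ hm).2
  rw [hfs₀] at h1
  rw [hm] at h2
  push_cast at h2
  obtain ⟨r, hr, hgr⟩ := intermediate_value_Ioo hs₀.2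
    (hg.mono (Icc_subset_Icc hs₀.1 hs.2))
    (show ((m + 1 : ℤ) : ℝ) ∈ Ioo (g s₀) (g s) by
      push_cast; exact ⟨by linarith [h1.2], by linarith [h2.1]⟩)
  exact ⟨s₀, r, hs₀.1, hr.1, hr.2, hfs₀,
    hgX r ⟨hs₀.1.trans hr.1.le, hr.2.le.trans hs.2⟩ _ hgr⟩

theorem two_mul_sub_le_variation (hT : 0 ≤ T) (hf : ContinuousOn f (Icc 0 T))
    (hg : ContinuousOn g (Icc 0 T))
    (hV : ∀ a b, 0 ≤ a → a ≤ b → b ≤ T → |X b - X a| ≤ V b - V a)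
    (hfX : ∀ t ∈ Icc 0 T, ∀ m : ℤ, f t = m + 1 / 2 → X t ≤ lo ∧ |g t - f t| < 1 / 2)
    (hgX : ∀ t ∈ Icc 0 T, ∀ m : ℤ, g t = m → hi ≤ X t) (hlohi : lo < hi) (hhi : -(1 / 2) < hi)
    (hL : ∀ t₁ s t₂, 0 ≤ t₁ → t₁ < s → s < t₂ → t₂ ≤ T → lo < X t₁ → X s ≤ lo → lo < X t₂ →
      ∃ t ∈ Ioo t₁ t₂, X t = -(1 / 2))
    (hR : ∀ t₁ s t₂, 0 ≤ t₁ → t₁ < s → s < t₂ → t₂ ≤ T → X t₁ < hi → hi ≤ X s → X t₂ < hi →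
      ∃ t ∈ Ioo t₁ t₂, X t = 1 / 2) :
    2 * (f T - f 0) - 8 ≤ V T - V 0 := by
  set m₀ := ⌈f 0 - 1 / 2⌉ with hm₀
  have hm₀1 : f 0 - 1 / 2 ≤ m₀ := Int.le_ceil _
  have hm₀2 : (m₀ : ℝ) < f 0 - 1 / 2 + 1 := Int.ceil_lt_add_one _
  -- The invariant keeps a touch `l` of the left wall followed by a visit `r` to the right, with `s`
  -- on the left. One more level of `f` gives a touch of the right wall and then another of the left
  -- wall, which adds `1 + 1` to the variation. Two levels are spent on the first touch.
  have key : ∀ j : ℕ, ∀ s ∈ Icc 0 T, f s = (m₀ + j + 1 + 1 : ℤ) + 1 / 2 →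
      ∃ l r, 0 ≤ l ∧ l < r ∧ r < s ∧ X l = -(1 / 2) ∧ hi ≤ X r ∧ V 0 + 2 * j ≤ V l := by
    intro j
    induction j with
    | zero =>
      intro s hs hfs
      obtain ⟨s₁, r₁, h1, h2, h3, h4, h5⟩ := exists_lt_lt_of_level hf hg hfX hgX hs
        (by push_cast; linarith) hfs
      obtain ⟨s₀, r₀, k1, k2, k3, k4, k5⟩ := exists_lt_lt_of_level hf hg hfX hgX
        (s := s₁) ⟨h1, by linarith [hs.2]⟩ (by push_cast; linarith) h4
      have hX1 := (hfX s₁ ⟨h1, by linarith [hs.2]⟩ _ h4).1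
      obtain ⟨l, hl, hlX⟩ := hL r₀ s₁ r₁ (by linarith) k3 h2 (by linarith [hs.2])
        (by linarith) hX1 (by linarith)
      refine ⟨l, r₁, by linarith [hl.1], hl.2, h3, hlX, h5, ?_⟩
      have := (abs_nonneg _).trans (hV 0 l le_rfl (by linarith [hl.1])
        (by linarith [hl.2, hs.2]))
      simp; linarith
    | succ j ih =>
      intro s hs hfs
      obtain ⟨s₁, r₁, h1, h2, h3, h4, h5⟩ := exists_lt_lt_of_level hf hg hfX hgX hs
        (by push_cast; nlinarith [(Nat.cast_nonneg j : (0 : ℝ) ≤ j)]) hfs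
      have hs₁T : s₁ ∈ Icc 0 T := ⟨h1, by linarith [hs.2]⟩
      obtain ⟨l₀, r₀, k1, k2, k3, k4, k5, k6⟩ := ih s₁ hs₁T (by
        rw [h4]; push_cast; ring)
      have hX1 := (hfX s₁ hs₁T _ h4).1
      obtain ⟨l, hl, hlX⟩ := hL r₀ s₁ r₁ (by linarith) k3 h2 (by linarith [hs.2])
        (by linarith) hX1 (by linarith)
      obtain ⟨q, hq, hqX⟩ := hR l₀ r₀ l k1 k2 hl.1 (by linarith [hl.2, hs.2])
        (by linarith) k5 (by linarith)
      refine ⟨l, r₁, by linarith [hl.1], hl.2, h3, hlX, h5, ?_⟩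
      have e1 := hV l₀ q k1 hq.1.le (by linarith [hl.2, hs.2, hq.2])
      have e2 := hV q l (by linarith [hq.1]) hq.2.le (by linarith [hl.2, hs.2])
      rw [hqX, k4] at e1
      rw [hqX, hlX] at e2
      norm_num at e1 e2
      push_cast; linarith
  have hmono : 0 ≤ V T - V 0 := (abs_nonneg _).trans (hV 0 T le_rfl hT le_rfl)
  by_cases hsmall : f T - f 0 ≤ 3
  · linarith
  · push Not at hsmall
    -- The level used for `n` is below `f 0 + n + 3`; together with the rounding of `n` this loses
    -- at most 4 turns, whence the 8 in the bound.
    obtain ⟨n, hn1, hn2⟩ : ∃ n : ℕ, (n : ℝ) ≤ f T - f 0 - 3 ∧ f T - f 0 - 3 < n + 1 :=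
      ⟨⌊f T - f 0 - 3⌋₊, Nat.floor_le (by linarith), Nat.lt_floor_add_one _⟩
    have hlev : (((m₀ + n + 1 + 1 : ℤ) : ℝ) + 1 / 2) ∈ Icc (f 0) (f T) := by
      push_cast; constructor
      · linarith [(Nat.cast_nonneg n : (0 : ℝ) ≤ n)]
      · linarith
    obtain ⟨s, hs, hfs⟩ := intermediate_value_Icc hT hf hlev
    obtain ⟨l, r, h1, h2, h3, -, -, h4⟩ := key n s hs hfs
    have := (abs_nonneg _).trans (hV l T h1 (by linarith [hs.2]) le_rfl)
    linarith

theorem two_mul_abs_sub_le_variation (hT : 0 ≤ T) (hf : ContinuousOn f (Icc 0 T))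
    (hg : ContinuousOn g (Icc 0 T))
    (hV : ∀ a b, 0 ≤ a → a ≤ b → b ≤ T → |X b - X a| ≤ V b - V a)
    (hfX : ∀ t ∈ Icc 0 T, ∀ m : ℤ, f t = m + 1 / 2 → X t ≤ lo ∧ |g t - f t| < 1 / 2)
    (hgX : ∀ t ∈ Icc 0 T, ∀ m : ℤ, g t = m → hi ≤ X t) (hlohi : lo < hi) (hhi : -(1 / 2) < hi)
    (hL : ∀ t₁ s t₂, 0 ≤ t₁ → t₁ < s → s < t₂ → t₂ ≤ T → lo < X t₁ → X s ≤ lo → lo < X t₂ →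
      ∃ t ∈ Ioo t₁ t₂, X t = -(1 / 2))
    (hR : ∀ t₁ s t₂, 0 ≤ t₁ → t₁ < s → s < t₂ → t₂ ≤ T → X t₁ < hi → hi ≤ X s → X t₂ < hi →
      ∃ t ∈ Ioo t₁ t₂, X t = 1 / 2) :
    2 * |f T - f 0| - 8 ≤ V T - V 0 := by
  rcases abs_cases (f T - f 0) with ⟨h, -⟩ | ⟨h, -⟩
  · rw [h]; exact two_mul_sub_le_variation hT hf hg hV hfX hgX hlohi hhi hL hR
  -- The hypotheses are invariant under time reversal, which changes the sign of the increment of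
  -- `f`.
  · have hrev : ∀ t ∈ Icc 0 T, T - t ∈ Icc 0 T := fun t ht => ⟨by linarith [ht.2], by
      linarith [ht.1]⟩
    have hc : ContinuousOn (fun t => T - t) (Icc 0 T) := by fun_prop
    have := two_mul_sub_le_variation (f := fun t => f (T - t)) (g := fun t => g (T - t))
      (X := fun t => X (T - t)) (V := fun t => - V (T - t)) hT (hf.comp hc hrev)
      (hg.comp hc hrev)
      (fun a b ha hab hb => by
        have := hV (T - b) (T - a) (by linarith) (by linarith) (by linarith)
        rw [abs_sub_comm]; linarith)
      (fun t ht => hfX _ (hrev t ht)) (fun t ht => hgX _ (hrev t ht)) hlohi hhi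
      (fun t₁ s t₂ h1 h2 h3 h4 e1 e2 e3 => by
        obtain ⟨t, ht, htX⟩ := hL (T - t₂) (T - s) (T - t₁) (by linarith) (by linarith)
          (by linarith) (by linarith) e3 e2 e1
        exact ⟨T - t, ⟨by linarith [ht.2], by linarith [ht.1]⟩, by simpa using htX⟩)
      (fun t₁ s t₂ h1 h2 h3 h4 e1 e2 e3 => by
        obtain ⟨t, ht, htX⟩ := hR (T - t₂) (T - s) (T - t₁) (by linarith) (by linarith)
          (by linarith) (by linarith) e3 e2 e1
        exact ⟨T - t, ⟨by linarith [ht.2], by linarith [ht.1]⟩, by simpa using htX⟩)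
    simp only [sub_self, sub_zero] at this
    rw [h]; linarith

end Counting

/-! ### Variation of the coordinates along a trajectory -/

theorem abs_add_abs_le_sqrt_two (w : Plane) : |w 0| + |w 1| ≤ √2 * ‖w‖ := by
  rw [EuclideanSpace.norm_eq, ← Real.sqrt_mul (by norm_num)]
  apply Real.le_sqrt_of_sq_le
  simp only [Fin.sum_univ_two, Real.norm_eq_abs]
  nlinarith [sq_nonneg (|w 0| - |w 1|)]

/-- `V i` is the integral of the absolute value of the `i`-th velocity component. The right
derivative exists everywhere on `[0, T)`, so the segments of the curve need not be enumerated. -/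
theorem IsTrajectoryPiece.exists_variation {O : Set Plane} {T : ℝ} {γ : ℝ → Plane}
    (h : IsTrajectoryPiece O T γ) : ∃ V : Fin 2 → ℝ → ℝ,
      (∀ i a b, 0 ≤ a → a ≤ b → b ≤ T → |γ b i - γ a i| ≤ V i b - V i a) ∧
      (V 0 T - V 0 0) + (V 1 T - V 1 0) ≤ √2 * T := by
  set w : ℝ → Plane := (Ico 0 T).indicator fun t => derivWithin γ (Ioi t) t with hw
  have hwm : Measurable w := (measurable_derivWithin_Ioi γ).indicator measurableSet_Ico
  have hder : ∀ t ∈ Ico 0 T, HasDerivWithinAt γ (w t) (Ioi t) t ∧ ‖w t‖ = 1 := by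
    intro t ht
    obtain ⟨v, hv, hv'⟩ := h.exists_velocityAfter ht
    have h1 : HasDerivWithinAt γ v (Ioi t) t := hv'.hasDerivWithinAt.mono Ioi_subset_Ici_self
    have h2 : w t = v := by
      rw [hw, indicator_of_mem ht, h1.derivWithin (uniqueDiffWithinAt_Ioi t)]
    rw [h2]; exact ⟨h1, hv⟩
  have hbound : ∀ t, ‖w t‖ ≤ 1 := fun t => by
    by_cases ht : t ∈ Ico 0 T
    · exact (hder t ht).2.le
    · rw [hw, indicator_of_notMem ht]; simp
  have hcoord : ∀ (i : Fin 2) t, ‖w t i‖ ≤ 1 := fun i t =>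
    (PiLp.norm_apply_le (w t) i).trans (hbound t)
  have hmeas : ∀ i : Fin 2, Measurable fun t => w t i := fun i =>
    (by fun_prop : Continuous fun p : Plane => p i).measurable.comp hwm
  have hint : ∀ (i : Fin 2) a b, IntervalIntegrable (fun t => w t i) MeasureTheory.volume a b :=
    fun i a b => (intervalIntegrable_const (c := (1 : ℝ))).mono_fun
      (hmeas i).aestronglyMeasurable (Eventually.of_forall fun t => by simpa using hcoord i t)
  refine ⟨fun i t => ∫ s in (0 : ℝ)..t, |w s i|, fun i a b ha hab hb => ?_, ?_⟩
  · have e1 : ∫ s in a..b, w s i = γ b i - γ a i := by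
      refine intervalIntegral.integral_eq_sub_of_hasDeriv_right (f := fun t => γ t i) ?_ ?_
        (hint i a b)
      · rw [uIcc_of_le hab]
        exact (by fun_prop : Continuous fun p : Plane => p i).comp_continuousOn
          (h.continuousOn.mono (Icc_subset_Icc ha hb))
      · intro t ht
        rw [min_eq_left hab, max_eq_right hab] at ht
        have h1 := (hder t ⟨ha.trans ht.1.le, ht.2.trans_le hb⟩).1
        exact (EuclideanSpace.proj i : Plane →L[ℝ] ℝ).hasFDerivAt.comp_hasDerivWithinAt t h1
    have e2 := intervalIntegral.integral_interval_sub_left (hint i 0 b).abs (hint i 0 a).abs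
    simp only at e2 ⊢
    rw [e2, ← e1]
    exact intervalIntegral.abs_integral_le_integral_abs hab
  · simp only [intervalIntegral.integral_same, sub_zero]
    rw [← intervalIntegral.integral_add (hint 0 0 T).abs (hint 1 0 T).abs]
    have := intervalIntegral.integral_mono_on (μ := MeasureTheory.volume) h.pos.le
      ((hint 0 0 T).abs.add (hint 1 0 T).abs)
      (intervalIntegrable_const (c := √2)) (fun t _ => (abs_add_abs_le_sqrt_two (w t)).trans
        (mul_le_of_le_one_right (Real.sqrt_nonneg 2) (hbound t)))
    simpa [mul_comm] using this

/-! ### The upper bound for the rotation speed -/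

theorem isNormal_single {O : Set Plane} {i : Fin 2} {σ : ℝ} (hσ : σ = 1 ∨ σ = -1) {A : Plane}
    (hA : A ∈ O) (hmin : ∀ y ∈ O, σ * A i ≤ σ * y i) :
    IsNormal O A (EuclideanSpace.single i (-σ)) := by
  refine ⟨hA, ?_, fun y hy => ?_⟩
  · rcases hσ with rfl | rfl <;> simp
  · simp [EuclideanSpace.inner_single_left]; linarith [hmin y hy]

/-- An extreme point `A` of an obstacle in a coordinate direction, and an interior point `A'`
such that the ray from `A'` in this direction leaves the obstacle at `A`. -/
theorem IsObstacle.exists_extreme {O : Set Plane} (hO : IsObstacle O) (i : Fin 2) {σ : ℝ}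
    (hσ : σ = 1 ∨ σ = -1) : ∃ A ∈ O, (∀ y ∈ O, σ * A i ≤ σ * y i) ∧
      (∀ y ∈ interior O, σ * A i < σ * y i) ∧
      ∃ A' ∈ interior O, (∀ j ≠ i, A j = A' j) ∧
        ∀ p ∉ interior O, (∀ j ≠ i, p j = A' j) → σ * p i ≤ σ * A' i → σ * p i ≤ σ * A i := by
  have hcont : Continuous fun p : Plane => σ * p i := by fun_prop
  obtain ⟨A, hA, hmin⟩ := hO.isCompact.exists_isMinOn hO.isConnected.nonempty hcont.continuousOn
  have hn := isNormal_single hσ hA (fun y hy => hmin hy)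
  have hσσ : σ * σ = 1 := by rcases hσ with rfl | rfl <;> norm_num
  have hev := hn.eventually_mem_interior (u := EuclideanSpace.single i σ) hO.smooth_boundary (by
    rcases hσ with rfl | rfl <;> simp [EuclideanSpace.inner_single_left])
  obtain ⟨τ, hτ, hsub⟩ := mem_nhdsGT_iff_exists_Ioc_subset.1 hev
  have hτ : 0 < τ := hτ
  refine ⟨A, hA, fun y hy => hmin hy, fun y hy => ?_, A + τ • EuclideanSpace.single i σ,
    hsub ⟨hτ, le_rfl⟩, fun j hj => ?_, fun p hp hpj hpi => ?_⟩
  · have := hn.inner_lt hy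
    simp [EuclideanSpace.inner_single_left] at this; linarith
  · simp [hj]
  · by_contra hcon
    push Not at hcon
    refine hp ?_
    have hmem : σ * (p i - A i) ∈ Ioc 0 τ := by
      constructor
      · linarith
      · simp at hpi
        have : σ * (A i + τ * σ) = σ * A i + τ := by linear_combination τ * hσσ
        linarith
    have hpe : p = A + (σ * (p i - A i)) • EuclideanSpace.single i σ := by
      ext j
      by_cases hj : j = i
      · subst hj; simp; linear_combination (-(p j - A j)) * hσσ
      · rw [hpj j hj]; simp [hj]
    rw [hpe]; exact hsub hmem

/-- The coordinate other than the `i`-th one. -/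
def other (i : Fin 2) : Fin 2 := 1 - i

/-- The argument, in turns, of the `i`-th coordinate vector. -/
noncomputable def axisAngle (i : Fin 2) : ℝ := if i = 0 then 0 else 1 / 4

theorem HasAngle.coord {p : Plane} {θ : ℝ} {i : Fin 2} (h : HasAngle p (θ + axisAngle i)) :
    p i = ‖p‖ * Real.cos (2 * Real.pi * θ) ∧
      |p (other i)| = |‖p‖ * Real.sin (2 * Real.pi * θ)| := by
  have h0 := congrArg (fun q : Plane => q 0) h
  have h1 := congrArg (fun q : Plane => q 1) h
  fin_cases i
  · simp [axisAngle] at h0 h1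
    simp only [other]
    exact ⟨h0, by simpa using congrArg abs h1⟩
  · have e : 2 * Real.pi * (θ + 1 / 4) = 2 * Real.pi * θ + Real.pi / 2 := by ring
    simp only [axisAngle, Fin.mk_one, one_ne_zero, if_false, e, Real.cos_add_pi_div_two,
      Real.sin_add_pi_div_two, PiLp.smul_apply, smul_eq_mul] at h0 h1
    simp only [other]
    refine ⟨by simpa using h1, ?_⟩
    have := congrArg abs h0
    simpa using this

theorem hasAngle_axis {p : Plane} {i : Fin 2} (h0 : p i ≤ 0) (h1 : p (other i) = 0) :
    HasAngle p (1 / 2 + axisAngle i) := by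
  have hn : ‖p‖ = - p i := by
    rw [EuclideanSpace.norm_eq, Fin.sum_univ_two]
    fin_cases i
    · have h1 : p 1 = 0 := h1
      have h0 : p 0 ≤ 0 := h0
      simp [h1, Real.sqrt_sq_eq_abs, abs_of_nonpos h0]
    · have h1 : p 0 = 0 := h1
      have h0 : p 1 ≤ 0 := h0
      simp [h1, Real.sqrt_sq_eq_abs, abs_of_nonpos h0]
  rw [HasAngle, hn]
  fin_cases i
  · have h1 : p 1 = 0 := h1
    have e : 2 * Real.pi * (1 / 2 + axisAngle 0) = Real.pi := by rw [axisAngle, if_pos rfl]; ring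
    simp only [Fin.zero_eta, e]
    ext j; fin_cases j <;> simp [h1]
  · have h1 : p 0 = 0 := h1
    have e : 2 * Real.pi * (1 / 2 + axisAngle 1) = Real.pi / 2 + Real.pi := by
      rw [axisAngle, if_neg one_ne_zero]; ring
    simp only [Fin.mk_one, e]
    ext j; fin_cases j <;> simp [h1, Real.cos_add_pi, Real.sin_add_pi]

theorem forall_ne_iff_other {i : Fin 2} {P : Fin 2 → Prop} : (∀ j ≠ i, P j) ↔ P (other i) := by
  fin_cases i <;> simp [other, Fin.forall_fin_two]

/-- A continuous function on a connected set with `cos (2 π h) > 0` is within `1/4` of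
an integer. -/
theorem exists_int_abs_sub_lt {S : Set Plane} (hS : IsPreconnected S) {h : Plane → ℝ}
    (hc : ContinuousOn h S) (hcos : ∀ p ∈ S, 0 < Real.cos (2 * Real.pi * h p)) :
    ∃ k : ℤ, ∀ p ∈ S, |h p - k| < 1 / 4 := by
  rcases S.eq_empty_or_nonempty with rfl | ⟨A, hA⟩
  · exact ⟨0, by simp⟩
  have hcosk : ∀ k : ℤ, ∀ x : ℝ, Real.cos (2 * Real.pi * (x - k)) = Real.cos (2 * Real.pi * x) := by
    intro k x
    rw [← Real.cos_sub_int_mul_two_pi (2 * Real.pi * x) k]; congr 1; ring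
  set k := round (h A) with hk
  have hne : ∀ p ∈ S, h p - k ≠ 1 / 4 ∧ h p - k ≠ -(1 / 4) := by
    intro p hp
    have h1 := hcos p hp
    rw [← hcosk k] at h1
    constructor
    · intro h2
      rw [h2, show 2 * Real.pi * (1 / 4) = Real.pi / 2 by ring, Real.cos_pi_div_two] at h1
      exact lt_irrefl _ h1
    · intro h2
      rw [h2, show 2 * Real.pi * (-(1 / 4)) = -(Real.pi / 2) by ring, Real.cos_neg,
        Real.cos_pi_div_two] at h1
      exact lt_irrefl _ h1
  have hA' : |h A - k| < 1 / 4 := by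
    have h1 : |h A - k| ≤ 1 / 2 := abs_sub_round _
    have h2 := hcos A hA
    rw [← hcosk k] at h2
    by_contra hcon
    push Not at hcon
    rw [← Real.cos_abs, abs_mul, abs_of_pos Real.two_pi_pos] at h2
    refine absurd h2 (not_lt.2 (Real.cos_nonpos_of_pi_div_two_le_of_le ?_ ?_)) <;>
      nlinarith [Real.pi_pos]
  have hc' : ContinuousOn (fun p => h p - k) S := hc.sub continuousOn_const
  refine ⟨k, fun p hp => ?_⟩
  rw [abs_lt] at hA' ⊢
  constructor
  · by_contra hcon
    push Not at hcon
    obtain ⟨q, hq, hq'⟩ := hS.intermediate_value hp hA hc' ⟨hcon, hA'.1.le⟩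
    exact (hne q hq).2 hq'
  · by_contra hcon
    push Not at hcon
    obtain ⟨q, hq, hq'⟩ := hS.intermediate_value hA hp hc' ⟨hA'.2.le, hcon⟩
    exact (hne q hq).1 hq'

theorem isCompact_square : IsCompact square := by
  refine Metric.isCompact_of_isClosed_isBounded ?_ ?_
  · have : square = ⋂ i : Fin 2, {x : Plane | |x i| ≤ 1 / 2} := by ext x; simp [square]
    rw [this]
    exact isClosed_iInter fun i => isClosed_le (by fun_prop) continuous_const
  · refine (Metric.isBounded_closedBall (x := (0 : Plane)) (r := 1)).subset fun x hx => ?_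
    rw [mem_closedBall_zero_iff, EuclideanSpace.norm_eq, Real.sqrt_le_one, Fin.sum_univ_two]
    have h0 := abs_le.1 (hx 0)
    have h1 := abs_le.1 (hx 1)
    simp only [Real.norm_eq_abs, sq_abs]
    nlinarith

theorem isCompact_table (O : Set Plane) : IsCompact (table O) :=
  isCompact_square.diff isOpen_interior

theorem IsObstacle.coord_lt {O : Set Plane} (hO : IsObstacle O) {A : Plane} (hA : A ∈ O)
    (i : Fin 2) : |A i| < 1 / 2 := by
  have h := hO.subset_interior_square hA
  have key : ∀ σ : ℝ, ∃ t > 0, |A i + t * σ| ≤ 1 / 2 := fun σ => by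
    obtain ⟨t, ht, ht'⟩ := (((tendsto_add_smul A (EuclideanSpace.single i σ)).eventually
      (isOpen_interior.mem_nhds h)).and self_mem_nhdsWithin).exists
    exact ⟨t, ht', by simpa using (interior_subset ht) i⟩
  obtain ⟨t, ht, h1⟩ := key 1
  obtain ⟨s, hs, h2⟩ := key (-1)
  rw [abs_le] at h1 h2
  have ht : 0 < t := ht
  have hs : 0 < s := hs
  rw [abs_lt]; constructor <;> linarith

theorem IsObstacle.exists_variation_bound {O : Set Plane} (hO : IsObstacle O) {z : Plane}
    (hz : z ∈ interior O) (i : Fin 2) : ∃ C : ℝ, ∀ (γ : ℝ → Plane) (T d : ℝ) (V : ℝ → ℝ),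
      IsTrajectoryPiece O T γ → IsDisplacement z γ T d →
      (∀ a b, 0 ≤ a → a ≤ b → b ≤ T → |γ b i - γ a i| ≤ V b - V a) →
      2 * |d| - C ≤ V T - V 0 := by
  obtain ⟨A, hA, hAmin, hAint, A', hA', hAA', hAray⟩ := hO.exists_extreme i (Or.inl rfl : (1:ℝ) = 1 ∨ _)
  obtain ⟨B, hB, hBmin, hBint, B', hB', hBB', hBray⟩ :=
    hO.exists_extreme i (Or.inr rfl : (-1 : ℝ) = 1 ∨ (-1 : ℝ) = -1)
  simp only [one_mul, neg_mul, neg_le_neg_iff, neg_lt_neg_iff, forall_ne_iff_other] at *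
  obtain ⟨f₀, hf₀, hf₀'⟩ := hO.angleRel hz hA'
  obtain ⟨h, hh, hh'⟩ := hO.angleRel hA' hB'
  obtain ⟨M, hM⟩ := (isCompact_table O).exists_bound_of_continuousOn
    (hf₀.mono fun p hp => hp.2)
  -- The ray to the left of `A`. Seen from `A'` its points have argument exactly one half turn; seen
  -- from `B'` they lie in the left half-plane. So the difference `h` of the two arguments has
  -- positive cosine on it and stays near one integer `k`.
  set S : Set Plane := {p | p (other i) = A' (other i) ∧ p i ≤ A i} with hS
  have hSint : ∀ p ∈ S, p ∉ interior O := fun p hp hp' => absurd (hAint p hp') (not_lt.2 hp.2)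
  have hSconv : Convex ℝ S := by
    intro p hp q hq a b ha hb hab
    constructor
    · simp only [PiLp.add_apply, PiLp.smul_apply, smul_eq_mul, hp.1, hq.1]
      rw [← add_mul, hab, one_mul]
    · simp only [PiLp.add_apply, PiLp.smul_apply, smul_eq_mul]
      have h1 := mul_le_mul_of_nonneg_left hp.2 ha
      have h2 := mul_le_mul_of_nonneg_left hq.2 hb
      have h3 : a * A i + b * A i = A i := by rw [← add_mul, hab, one_mul]
      linarith
  obtain ⟨k, hk⟩ := exists_int_abs_sub_lt hSconv.isPreconnected
    (hh.mono fun p hp => hSint p hp) (fun p hp => by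
      have h1 : HasAngle (p - A') (1 / 2 + axisAngle i) :=
        hasAngle_axis (by simp; linarith [hp.2, hAint A' hA']) (by simp [hp.1])
      have h2 := (hh' p (hSint p hp) _).1 h1
      rw [add_sub_right_comm] at h2
      have h3 := h2.coord.1
      have h4 : (p - B') i < 0 := by simp; linarith [hp.2, hAint B' hB']
      have e : 2 * Real.pi * (1 / 2 - h p) = Real.pi - 2 * Real.pi * h p := by ring
      rw [e, Real.cos_pi_sub] at h3
      by_contra hcon
      push Not at hcon
      have := mul_nonneg (norm_nonneg (p - B')) (neg_nonneg.2 hcon)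
      linarith)
  refine ⟨4 * M + 8, fun γ T d V hγ hd hV => ?_⟩
  obtain ⟨φ, hφ, hφ', rfl⟩ := hd
  have hγint : ∀ t ∈ Icc 0 T, γ t ∉ interior O := fun t ht => hγ.notMem_interior ht
  have hcf₀ : ContinuousOn (fun t => f₀ (γ t)) (Icc 0 T) := hf₀.comp hγ.continuousOn hγint
  have hch : ContinuousOn (fun t => h (γ t)) (Icc 0 T) := hh.comp hγ.continuousOn hγint
  set f : ℝ → ℝ := fun t => φ t - f₀ (γ t) - axisAngle i with hf
  -- Adding `k` normalizes the argument about `B'`, so that it differs from `f` by less than `1/4`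
  -- on the left ray and is still an integer on the right ray.
  set g : ℝ → ℝ := fun t => f t - h (γ t) + k with hg
  have hcf : ContinuousOn f (Icc 0 T) := (hφ.sub hcf₀).sub continuousOn_const
  have hcg : ContinuousOn g (Icc 0 T) := (hcf.sub hch).add continuousOn_const
  have hfA : ∀ t ∈ Icc 0 T, HasAngle (γ t - A') (f t + axisAngle i) := fun t ht => by
    have := (hf₀' _ (hγint t ht) (φ t)).1 (hφ' t ht)
    simpa [hf] using this
  have hgB : ∀ t ∈ Icc 0 T, HasAngle (γ t - B') (g t - k + axisAngle i) := fun t ht => by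
    have := (hh' _ (hγint t ht) _).1 (hfA t ht)
    convert this using 1
    simp only [hg]; ring
  have hmain := two_mul_abs_sub_le_variation (X := fun t => γ t i) (lo := A i) (hi := B i)
    hγ.pos.le hcf hcg hV
    (fun t ht m hm => by
      obtain ⟨h1, h2⟩ := (hfA t ht).coord
      have e : 2 * Real.pi * f t = Real.pi + m * (2 * Real.pi) := by rw [hm]; ring
      rw [e, Real.cos_add_int_mul_two_pi, Real.cos_pi] at h1
      rw [e, Real.sin_add_int_mul_two_pi, Real.sin_pi, mul_zero, abs_zero, abs_eq_zero] at h2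
      simp only [PiLp.sub_apply, sub_eq_zero] at h1 h2
      have h3 : γ t i ≤ A i := hAray _ (hγint t ht) h2 (by linarith [norm_nonneg (γ t - A')])
      refine ⟨h3, ?_⟩
      have h4 := hk (γ t) ⟨h2, h3⟩
      have e2 : g t - f t = -(h (γ t) - k) := by simp only [hg]; ring
      rw [e2, abs_neg]; linarith)
    (fun t ht m hm => by
      obtain ⟨h1, h2⟩ := (hgB t ht).coord
      have e : 2 * Real.pi * (g t - k) = ((m - k : ℤ) : ℝ) * (2 * Real.pi) := by
        rw [hm]; push_cast; ring
      rw [e, Real.cos_int_mul_two_pi] at h1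
      rw [e, show ((m - k : ℤ) : ℝ) * (2 * Real.pi) = 0 + ((m - k : ℤ) : ℝ) * (2 * Real.pi) by
        ring, Real.sin_add_int_mul_two_pi, Real.sin_zero, mul_zero, abs_zero, abs_eq_zero] at h2
      simp only [PiLp.sub_apply, sub_eq_zero] at h1 h2
      exact hBray _ (hγint t ht) h2 (by linarith [norm_nonneg (γ t - B')]))
    ((hAint B' hB').trans (hBint B' hB')) (abs_lt.1 (hO.coord_lt hB i)).1
    (fun t₁ s t₂ h0 h1 h2 hT e1 e2 e3 => by
      simpa using hγ.exists_coord_eq_neg_half hO.smooth_boundary (Or.inl rfl : (1:ℝ) = 1 ∨ _)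
        (A := A) (i := i) (by simpa using hAmin) h0 h1 h2 hT (by simpa using e1)
        (by simpa using e2) (by simpa using e3))
    (fun t₁ s t₂ h0 h1 h2 hT e1 e2 e3 => by
      simpa using hγ.exists_coord_eq_neg_half hO.smooth_boundary
        (Or.inr rfl : (-1 : ℝ) = 1 ∨ (-1 : ℝ) = -1)
        (A := B) (i := i) (by simpa using hBmin) h0 h1 h2 hT (by simpa using e1)
        (by simpa using e2) (by simpa using e3))
  have hM0 := abs_le.1 (hM _ (hγ.mem_table 0 ⟨le_rfl, hγ.pos.le⟩))
  have hMT := abs_le.1 (hM _ (hγ.mem_table T ⟨hγ.pos.le, le_rfl⟩))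
  have habs : |φ T - φ 0| ≤ |f T - f 0| + 2 * M := by
    have e : φ T - φ 0 = (f T - f 0) + (f₀ (γ T) - f₀ (γ 0)) := by simp only [hf]; ring
    rw [e]
    refine (abs_add_le _ _).trans ?_
    have : |f₀ (γ T) - f₀ (γ 0)| ≤ 2 * M := abs_le.2 ⟨by linarith, by linarith⟩
    linarith
  linarith

theorem IsObstacle.exists_displacement_bound {O : Set Plane} (hO : IsObstacle O) {z : Plane}
    (hz : z ∈ interior O) : ∃ C : ℝ, ∀ (γ : ℝ → Plane) (T d : ℝ),
      IsTrajectoryPiece O T γ → IsDisplacement z γ T d → |d| ≤ √2 / 4 * T + C := by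
  obtain ⟨C₀, h₀⟩ := hO.exists_variation_bound hz 0
  obtain ⟨C₁, h₁⟩ := hO.exists_variation_bound hz 1
  refine ⟨(C₀ + C₁) / 4, fun γ T d hγ hd => ?_⟩
  obtain ⟨V, hV, hVT⟩ := hγ.exists_variation
  have e0 := h₀ γ T d (V 0) hγ hd (hV 0)
  have e1 := h₁ γ T d (V 1) hγ hd (hV 1)
  linarith

theorem IsObstacle.rotationSet_subset {O : Set Plane} (hO : IsObstacle O) {z : Plane}
    (hz : z ∈ interior O) : rotationSet O z ⊆ Icc (-(√2 / 4)) (√2 / 4) := by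
  obtain ⟨C, hC⟩ := hO.exists_displacement_bound hz
  rintro ρ ⟨γ, T, d, h, hT, hρ⟩
  rw [mem_Icc, ← abs_le]
  have hlim : Tendsto (fun n => √2 / 4 + C / T n) atTop (𝓝 (√2 / 4 + 0)) :=
    tendsto_const_nhds.add (hT.const_div_atTop C)
  rw [add_zero] at hlim
  refine le_of_tendsto_of_tendsto' hρ.abs hlim fun n => ?_
  have hpos := (h n).1.pos
  rw [abs_div, abs_of_pos hpos, div_le_iff₀ hpos, add_mul, div_mul_cancel₀ _ hpos.ne']
  exact hC _ _ _ (h n).1 (h n).2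

/-! ### Scattering by a family of separated obstacles in the plane -/

/-- The image of `v` under the reflection in the line orthogonal to the unit vector `n`. -/
noncomputable def reflect (n v : Plane) : Plane := v - (2 * ⟪n, v⟫) • n

theorem inner_reflect {n : Plane} (hn : ‖n‖ = 1) (v : Plane) : ⟪n, reflect n v⟫ = -⟪n, v⟫ := by
  rw [reflect, inner_sub_right, inner_smul_right, real_inner_self_eq_norm_sq, hn]; ring

theorem reflect_reflect {n : Plane} (hn : ‖n‖ = 1) (v : Plane) : reflect n (reflect n v) = v := by
  rw [reflect, inner_reflect hn, reflect]; module

theorem reflect_eq_self {n v : Plane} (h : ⟪n, v⟫ = 0) : reflect n v = v := by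
  simp [reflect, h]

theorem norm_reflect {n : Plane} (hn : ‖n‖ = 1) (v : Plane) : ‖reflect n v‖ = ‖v‖ := by
  have h : ‖reflect n v‖ ^ 2 = ‖v‖ ^ 2 := by
    rw [reflect, norm_sub_sq_real, inner_smul_right, norm_smul, hn, Real.norm_eq_abs, mul_one,
      sq_abs, real_inner_comm v n]
    ring
  exact (sq_eq_sq₀ (norm_nonneg _) (norm_nonneg _)).1 h

/-- A unit outer normal. -/
structure IsUnitNormal (O : Set Plane) (a n : Plane) : Prop extends IsNormal O a n where
  norm_eq : ‖n‖ = 1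

/-- A family of closed regions with normals at all boundary points, any two of which
are at distance more than `τ`. -/
structure IsScatterer {ι : Type*} (C : ι → Set Plane) (τ : ℝ) : Prop where
  pos : 0 < τ
  isClosed : ∀ k, IsClosed (C k)
  exists_normal : ∀ k, ∀ a ∈ C k, a ∉ interior (C k) → ∃ n, IsUnitNormal (C k) a n
  enter : ∀ k a n u, IsNormal (C k) a n → ⟪n, u⟫ < 0 →
    ∀ᶠ t in 𝓝[>] (0 : ℝ), a + t • u ∈ interior (C k)
  separated : ∀ k l x y, x ∈ C k → y ∈ C l → ‖x - y‖ ≤ τ → k = l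

/-- The point `p` is not in the interior of any of the regions. -/
def Free {ι : Type*} (C : ι → Set Plane) (p : Plane) : Prop := ∀ k, p ∉ interior (C k)

/-- The motion with velocity `v` on the time interval `[0, s]` and velocity `w` afterwards. -/
noncomputable def brokenPath (p v : Plane) (s : ℝ) (w : Plane) (u : ℝ) : Plane :=
  p + min u s • v + max (u - s) 0 • w

/-- The motion during the time `τ`, with at most one reflection, at time `s`. -/
structure Step {ι : Type*} (C : ι → Set Plane) (τ : ℝ) (p v : Plane) (s : ℝ) (p' v' : Plane) :
    Prop where
  mem_Icc : s ∈ Icc 0 τ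
  eq_add : p' = p + s • v + (τ - s) • v'
  law : (v' = v ∧ ∀ u ∈ Icc 0 τ, Free C (p + u • v)) ∨
    ∃ k n, IsUnitNormal (C k) (p + s • v) n ∧ ⟪n, v⟫ ≤ 0 ∧ v' = reflect n v

/-- Two velocities at the point `p` are the same up to a reflection. -/
def VelocityEquiv {ι : Type*} (C : ι → Set Plane) (p v w : Plane) : Prop :=
  v = w ∨ ∃ k n, IsUnitNormal (C k) p n ∧ w = reflect n v

section

variable {ι : Type*} {C : ι → Set Plane} {τ : ℝ} {p v w p' v' p₁ v₁ p₂ v₂ n n' a : Plane}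
  {s s₁ s₂ : ℝ} {k l : ι}

namespace IsScatterer

/-- By `enter`, directions pointing into one supporting half-plane enter the region, so they point
into the other one as well. -/
theorem normal_unique (hC : IsScatterer C τ) (h : IsUnitNormal (C k) a n)
    (h' : IsUnitNormal (C k) a n') : n = n' := by
  obtain ⟨c, hc, hn⟩ := exists_eq_smul_of_halfSpace (n := n') h.ne_zero fun u hu => by
    obtain ⟨t, ht1, ht2⟩ := ((hC.enter k a n u h.toIsNormal hu).and self_mem_nhdsWithin).exists
    have ht2 : 0 < t := ht2
    have h3 := h'.inner_lt ht1
    rw [add_sub_cancel_left, inner_smul_right] at h3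
    exact (neg_of_mul_neg_right h3 ht2.le).le
  have h1 := h'.norm_eq
  rw [hn, norm_smul, h.norm_eq, mul_one, Real.norm_of_nonneg hc] at h1
  rw [hn, h1, one_smul]

theorem inner_nonneg_of_free (hC : IsScatterer C τ) (h : IsNormal (C k) a n) {ε : ℝ} (hε : 0 < ε)
    (hfree : ∀ u ∈ Ioc 0 ε, a + u • v ∉ interior (C k)) : 0 ≤ ⟪n, v⟫ := by
  by_contra hcon
  push Not at hcon
  obtain ⟨t, ht1, ht2⟩ := ((hC.enter k a n v h hcon).and (Ioc_mem_nhdsGT hε)).exists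
  exact hfree t ht2 ht1

theorem eq_of_mem (hC : IsScatterer C τ) (hv : ‖v‖ = 1) (hp : p ∈ C k) (ha : p + s • v ∈ C l)
    (hs : |s| ≤ τ) : k = l := by
  refine hC.separated k l _ _ hp ha ?_
  rw [sub_add_cancel_left, norm_neg, norm_smul, hv, mul_one]; exact hs

end IsScatterer

/-- A line that leaves a region without having entered it is tangent to it. -/
theorem IsUnitNormal.tangent (h : IsUnitNormal (C k) (p + s • v) n) (hn : ⟪n, v⟫ ≤ 0) (hs : 0 < s)
    (hp : p ∈ C k) : ⟪n, v⟫ = 0 ∧ IsUnitNormal (C k) p n := by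
  have h1 := h.inner_le p hp
  rw [sub_add_cancel_left, inner_neg_right, inner_smul_right] at h1
  have h0 : ⟪n, v⟫ = 0 := by
    refine le_antisymm hn ?_
    by_contra hcon
    push Not at hcon
    have := mul_neg_of_pos_of_neg hs hcon
    linarith
  refine ⟨h0, ⟨hp, h.ne_zero, fun y hy => ?_⟩, h.norm_eq⟩
  have h2 := h.inner_le y hy
  rw [← sub_sub, inner_sub_right, inner_smul_right, h0, mul_zero, sub_zero] at h2
  exact h2

/-! ### One step of the motion: no penetration, uniqueness up to a reflection, existence -/

namespace Step

theorem norm_eq (h : Step C τ p v s p' v') (hv : ‖v‖ = 1) : ‖v'‖ = 1 := by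
  rcases h.law with ⟨rfl, -⟩ | ⟨k, n, hn, -, rfl⟩
  · exact hv
  · rw [norm_reflect hn.norm_eq, hv]

/-- In the case of a hit, freedom need not be assumed. Both legs stay within `τ` of the hit point,
so only the region hit could be met, and both lie in the closed half-plane beyond its supporting
line. -/
theorem free_brokenPath (hC : IsScatterer C τ) (h : Step C τ p v s p' v') (hv : ‖v‖ = 1) {u : ℝ}
    (hu : u ∈ Icc 0 τ) : Free C (brokenPath p v s v' u) := by
  have hv' := h.norm_eq hv
  rcases h.law with ⟨rfl, hf⟩ | ⟨k, n, hn, hnv, hv'e⟩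
  · have : brokenPath p v' s v' u = p + u • v' := by
      rw [brokenPath, add_assoc, ← add_smul]
      rcases le_total u s with h' | h'
      · rw [min_eq_left h', max_eq_right (by linarith), add_zero]
      · rw [min_eq_right h', max_eq_left (by linarith)]; congr 2; ring
    rw [this]; exact hf u hu
  · intro l hl
    rcases le_total u s with h' | h'
    · have e : brokenPath p v s v' u = (p + s • v) + (-(s - u)) • v := by
        rw [brokenPath, min_eq_left h', max_eq_right (by linarith)]; module
      rw [e] at hl
      have hkl := hC.eq_of_mem hv hn.mem (interior_subset hl) (by
        rw [abs_neg, abs_of_nonneg (by linarith)]; linarith [h.mem_Icc.2, hu.1])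
      subst hkl
      have := hn.inner_lt hl
      rw [add_sub_cancel_left, inner_smul_right] at this
      nlinarith
    · have e : brokenPath p v s v' u = (p + s • v) + (u - s) • v' := by
        rw [brokenPath, min_eq_right h', max_eq_left (by linarith)]
      rw [e] at hl
      have hkl := hC.eq_of_mem hv' hn.mem (interior_subset hl) (by
        rw [abs_of_nonneg (by linarith)]; linarith [h.mem_Icc.1, hu.2])
      subst hkl
      have := hn.inner_lt hl
      rw [add_sub_cancel_left, inner_smul_right, hv'e, inner_reflect hn.norm_eq] at this
      nlinarith

theorem brokenPath_end (h : Step C τ p v s p' v') : brokenPath p v s v' τ = p' := by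
  rw [brokenPath, min_eq_right h.mem_Icc.2, max_eq_left (by linarith [h.mem_Icc.2]), h.eq_add]

theorem free (hC : IsScatterer C τ) (h : Step C τ p v s p' v') (hv : ‖v‖ = 1) : Free C p' := by
  rw [← h.brokenPath_end]; exact h.free_brokenPath hC hv ⟨hC.pos.le, le_rfl⟩

theorem straight (h : Step C τ p v s p' v') (hv : v' = v) : p' = p + τ • v := by
  rw [h.eq_add, hv]; module

/-- A start on the boundary is decided at once: an ingoing velocity is reflected at time 0, any
other is kept. A later hit within the step would concern the same region and hence be tangent, with
no effect. -/
theorem of_mem (hC : IsScatterer C τ) (h : Step C τ p v s p' v') (hv : ‖v‖ = 1)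
    (hn : IsUnitNormal (C k) p n) :
    v' = (if ⟪n, v⟫ < 0 then reflect n v else v) ∧ p' = p + τ • v' := by
  suffices hs : v' = (if ⟪n, v⟫ < 0 then reflect n v else v) ∧ (v' = v ∨ s = 0) by
    refine ⟨hs.1, ?_⟩
    rcases hs.2 with h' | h'
    · rw [h.straight h', h']
    · rw [h.eq_add, h']; module
  rcases h.law with ⟨rfl, hf⟩ | ⟨l, m, hm, hmv, hv'⟩
  · have := hC.inner_nonneg_of_free hn.toIsNormal (v := v') hC.pos fun u hu =>
      hf u ⟨hu.1.le, hu.2⟩ k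
    rw [if_neg (not_lt.2 this)]; exact ⟨rfl, Or.inl rfl⟩
  · have hkl := hC.eq_of_mem hv hn.mem hm.mem (by
      rw [abs_of_nonneg h.mem_Icc.1]; exact h.mem_Icc.2)
    subst hkl
    rcases h.mem_Icc.1.eq_or_lt with h0 | h0
    · rw [← h0, zero_smul, add_zero] at hm
      have := hC.normal_unique hm hn
      subst this
      refine ⟨?_, Or.inr h0.symm⟩
      split_ifs with hlt
      · exact hv'
      · rw [hv', reflect_eq_self (le_antisymm hmv (not_lt.1 hlt))]
    · obtain ⟨h1, h2⟩ := hm.tangent hmv h0 hn.mem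
      have := hC.normal_unique h2 hn
      subst this
      rw [if_neg (by rw [h1]; exact lt_irrefl _), hv', reflect_eq_self h1]
      exact ⟨rfl, Or.inl rfl⟩

/-- Free flight and a hit from the same state are compatible only if the hit occurs at the final
time `τ`, where the velocities differ by the reflection, or is tangent. -/
theorem eq_or_of_free_hit (hC : IsScatterer C τ) (h₁ : Step C τ p v s₁ p₁ v₁)
    (h₂ : Step C τ p v s₂ p₂ v₂) (hv₁ : v₁ = v)
    (hf : ∀ u ∈ Icc 0 τ, Free C (p + u • v)) (hn : IsUnitNormal (C k) (p + s₂ • v) n)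
    (hnv : ⟪n, v⟫ ≤ 0) (hv₂ : v₂ = reflect n v) : p₁ = p₂ ∧ VelocityEquiv C p₁ v₁ v₂ := by
  rcases h₂.mem_Icc.2.eq_or_lt with hs | hs
  · have e1 := h₁.straight hv₁
    have e2 := h₂.eq_add
    rw [hs, sub_self, zero_smul, add_zero] at e2
    rw [hs] at hn
    refine ⟨e1.trans e2.symm, Or.inr ⟨k, n, ?_, ?_⟩⟩
    · rw [e1]; exact hn
    · rw [hv₂, hv₁]
  · have := hC.inner_nonneg_of_free hn.toIsNormal (v := v) (ε := τ - s₂) (by linarith)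
      fun u hu => by
        rw [add_assoc, ← add_smul]
        exact hf _ ⟨by linarith [h₂.mem_Icc.1, hu.1], by linarith [hu.2]⟩ k
    have hv : v₂ = v := by rw [hv₂, reflect_eq_self (le_antisymm hnv this)]
    rw [h₁.straight hv₁, h₂.straight hv, hv, hv₁]
    exact ⟨rfl, Or.inl rfl⟩

/-- Both hits are on the same region, and its supporting line at the later point already bounds the
earlier one. So the line of motion is the common tangent and neither reflection changes `v`. -/
theorem eq_of_hit_lt_hit (hC : IsScatterer C τ) (h₁ : Step C τ p v s₁ p₁ v₁)
    (h₂ : Step C τ p v s₂ p₂ v₂) (hv : ‖v‖ = 1) (hn₁ : IsUnitNormal (C k) (p + s₁ • v) n)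
    (hv₁ : v₁ = reflect n v) (hn₂ : IsUnitNormal (C l) (p + s₂ • v) n')
    (hnv₂ : ⟪n', v⟫ ≤ 0) (hv₂ : v₂ = reflect n' v) (hs : s₁ < s₂) :
    p₁ = p₂ ∧ v₁ = v₂ := by
  have e : p + s₂ • v = (p + s₁ • v) + (s₂ - s₁) • v := by module
  rw [e] at hn₂
  have hkl := hC.eq_of_mem hv hn₁.mem hn₂.mem (by
    rw [abs_of_nonneg (by linarith)]; linarith [h₁.mem_Icc.1, h₂.mem_Icc.2])
  subst hkl
  obtain ⟨h3, h4⟩ := hn₂.tangent hnv₂ (by linarith) hn₁.mem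
  have := hC.normal_unique h4 hn₁
  subst this
  rw [reflect_eq_self h3] at hv₁ hv₂
  rw [h₁.straight hv₁, h₂.straight hv₂, hv₁, hv₂]
  exact ⟨rfl, rfl⟩

theorem unique_of_same (hC : IsScatterer C τ) (h₁ : Step C τ p v s₁ p₁ v₁)
    (h₂ : Step C τ p v s₂ p₂ v₂) (hv : ‖v‖ = 1) : p₁ = p₂ ∧ VelocityEquiv C p₁ v₁ v₂ := by
  have hsymm : ∀ {x y z : Plane}, VelocityEquiv C x y z → VelocityEquiv C x z y := by
    rintro x y z (rfl | ⟨k, n, hn, rfl⟩)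
    · exact Or.inl rfl
    · exact Or.inr ⟨k, n, hn, (reflect_reflect hn.norm_eq y).symm⟩
  rcases h₁.law with ⟨e₁, hf₁⟩ | ⟨k, n, hn, hnv, hv₁⟩ <;>
    rcases h₂.law with ⟨e₂, hf₂⟩ | ⟨l, n', hn', hnv', hv₂⟩
  · rw [h₁.straight e₁, h₂.straight e₂, e₁, e₂]
    exact ⟨rfl, Or.inl rfl⟩
  · exact h₁.eq_or_of_free_hit hC h₂ e₁ hf₁ hn' hnv' hv₂
  · obtain ⟨h3, h4⟩ := h₂.eq_or_of_free_hit hC h₁ e₂ hf₂ hn hnv hv₁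
    exact ⟨h3.symm, h3 ▸ hsymm h4⟩
  · rcases lt_trichotomy s₁ s₂ with hs | hs | hs
    · obtain ⟨h3, h4⟩ := h₁.eq_of_hit_lt_hit hC h₂ hv hn hv₁ hn' hnv' hv₂ hs
      exact ⟨h3, Or.inl h4⟩
    · subst hs
      have hkl := hC.eq_of_mem (s := 0) hv hn.mem (by simpa using hn'.mem)
        (by simpa using hC.pos.le)
      subst hkl
      have := hC.normal_unique hn hn'
      subst this
      have hvv : v₁ = v₂ := hv₁.trans hv₂.symm
      refine ⟨?_, Or.inl hvv⟩
      rw [h₁.eq_add, h₂.eq_add, hvv]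
    · obtain ⟨h3, h4⟩ := h₂.eq_of_hit_lt_hit hC h₁ hv hn' hv₂ hn hnv hv₁ hs
      exact ⟨h3.symm, Or.inl h4.symm⟩

theorem unique (hC : IsScatterer C τ) (h₁ : Step C τ p v s₁ p₁ v₁)
    (h₂ : Step C τ p w s₂ p₂ v₂) (hv : ‖v‖ = 1) (hvw : VelocityEquiv C p v w) :
    p₁ = p₂ ∧ VelocityEquiv C p₁ v₁ v₂ := by
  rcases hvw with rfl | ⟨k, n, hn, rfl⟩
  · exact h₁.unique_of_same hC h₂ hv
  · obtain ⟨e1, e2⟩ := h₁.of_mem hC hv hn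
    obtain ⟨e3, e4⟩ := h₂.of_mem hC (by rw [norm_reflect hn.norm_eq, hv]) hn
    have hvv : v₁ = v₂ := by
      rw [e1, e3, inner_reflect hn.norm_eq, reflect_reflect hn.norm_eq]
      rcases lt_trichotomy ⟪n, v⟫ 0 with h | h | h
      · rw [if_pos h, if_neg (by linarith)]
      · rw [if_neg (by linarith), if_neg (by linarith), reflect_eq_self h]
      · rw [if_neg (by linarith), if_pos (by linarith)]
    refine ⟨?_, Or.inl hvv⟩
    rw [e2, e4, hvv]

/-- Existence of a motion during the time `τ`. -/
theorem exists_step (hC : IsScatterer C τ) (hp : Free C p) (v : Plane) :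
    ∃ s p' v', Step C τ p v s p' v' := by
  by_cases hf : ∀ u ∈ Icc 0 τ, Free C (p + u • v)
  · exact ⟨0, p + (0 : ℝ) • v + (τ - 0) • v, v, ⟨le_rfl, hC.pos.le⟩, rfl, Or.inl ⟨rfl, hf⟩⟩
  · simp only [not_forall, Free, not_not] at hf
    obtain ⟨u, hu, k, hk⟩ := hf
    have hcont : Continuous fun t : ℝ => p + t • v := by fun_prop
    -- The reflection takes place at the first meeting with a region whose interior the straight
    -- motion would enter. By `inner_lt`, this later interior point makes the velocity point inwards
    -- there.
    have hcomp : IsCompact (Icc 0 u ∩ (fun t : ℝ => p + t • v) ⁻¹' C k) :=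
      isCompact_Icc.inter_right ((hC.isClosed k).preimage hcont)
    obtain ⟨s, ⟨hs, hsC⟩, hleast⟩ := hcomp.exists_isLeast
      ⟨u, ⟨hu.1, le_rfl⟩, (interior_subset hk : p + u • v ∈ C k)⟩
    have hsint : p + s • v ∉ interior (C k) := by
      rcases hs.1.eq_or_lt with h0 | h0
      · rw [← h0, zero_smul, add_zero]; exact hp k
      · intro hmem
        have hev : ∀ᶠ t in 𝓝 s, p + t • v ∈ interior (C k) :=
          hcont.continuousAt.eventually (isOpen_interior.mem_nhds hmem)
        have hev2 : ∀ᶠ t in 𝓝[<] s, p + t • v ∈ interior (C k) ∧ t ∈ Ioo 0 s :=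
          (hev.filter_mono nhdsWithin_le_nhds).and (Ioo_mem_nhdsLT h0)
        obtain ⟨t, ht1, ht2⟩ := hev2.exists
        exact absurd (hleast ⟨⟨ht2.1.le, ht2.2.le.trans hs.2⟩,
          (interior_subset ht1 : p + t • v ∈ C k)⟩) (not_le.2 ht2.2)
    obtain ⟨n, hn⟩ := hC.exists_normal k _ hsC hsint
    refine ⟨s, _, reflect n v, ⟨hs.1, hs.2.trans hu.2⟩, rfl, Or.inr ⟨k, n, hn, ?_, rfl⟩⟩
    have := hn.inner_lt hk
    rw [add_sub_add_left_eq_sub, ← sub_smul, inner_smul_right] at this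
    exact (neg_of_mul_neg_right this (by linarith [hs.2])).le

end Step

theorem isClosed_setOf_free : IsClosed {p | Free C p} := by
  have : {p | Free C p} = ⋂ k, (interior (C k))ᶜ := by ext; simp [Free]
  rw [this]; exact isClosed_iInter fun k => isOpen_interior.isClosed_compl

/-- The relation `Step` is closed. -/
theorem step_of_tendsto (hC : IsScatterer C τ) {Θ : Type*} {U : Ultrafilter Θ}
    {fp fv fp' fv' : Θ → Plane} {fs : Θ → ℝ} (hp : Tendsto fp U (𝓝 p)) (hv : Tendsto fv U (𝓝 v))
    (hs : Tendsto fs U (𝓝 s)) (hp' : Tendsto fp' U (𝓝 p')) (hv' : Tendsto fv' U (𝓝 v'))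
    (h : ∀ θ, Step C τ (fp θ) (fv θ) (fs θ) (fp' θ) (fv' θ)) : Step C τ p v s p' v' := by
  have ha : Tendsto (fun θ => fp θ + fs θ • fv θ) U (𝓝 (p + s • v)) := hp.add (hs.smul hv)
  refine ⟨isClosed_Icc.mem_of_tendsto hs (Eventually.of_forall fun θ => (h θ).mem_Icc), ?_, ?_⟩
  · refine tendsto_nhds_unique hp' ?_
    simp only [funext fun θ => (h θ).eq_add]
    exact ha.add ((tendsto_const_nhds.sub hs).smul hv')
  -- An ultrafilter selects one of the two cases along the whole limit. In the second one the
  -- separation of the regions also fixes the index `k`, and compactness of the circle supplies a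
  -- limit of the normals.
  · rcases Ultrafilter.eventually_or.1 (Eventually.of_forall fun θ => (h θ).law) with hA | hB
    · left
      refine ⟨tendsto_nhds_unique hv' (hv.congr' (hA.mono fun θ hθ => hθ.1.symm)), fun u hu => ?_⟩
      exact isClosed_setOf_free.mem_of_tendsto (hp.add (hv.const_smul u))
        (hA.mono fun θ hθ => hθ.2 u hu)
    · right
      have hnear : ∀ᶠ θ in (U : Filter Θ), ‖fp θ + fs θ • fv θ - (p + s • v)‖ < τ / 2 := by
        have := (ha.sub_const (p + s • v)).norm
        rw [sub_self, norm_zero] at this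
        exact this.eventually (gt_mem_nhds (by linarith [hC.pos]))
      obtain ⟨θ₀, ⟨k, n₀, hn₀, -⟩, hθ₀⟩ := (hB.and hnear).exists
      have hBk : ∀ᶠ θ in (U : Filter Θ), ∃ n, IsUnitNormal (C k) (fp θ + fs θ • fv θ) n ∧
          ⟪n, fv θ⟫ ≤ 0 ∧ fv' θ = reflect n (fv θ) := by
        filter_upwards [hB, hnear] with θ hθ hθ'
        obtain ⟨l, n, hn, hn'⟩ := hθ
        have : l = k := hC.separated l k _ _ hn.mem hn₀.mem (by
          rw [← sub_sub_sub_cancel_right _ _ (p + s • v)]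
          exact (norm_sub_le _ _).trans (by linarith))
        subst this
        exact ⟨n, hn, hn'⟩
      classical
      have hch : ∀ θ, ∃ n : Plane, (∃ n, IsUnitNormal (C k) (fp θ + fs θ • fv θ) n ∧
          ⟪n, fv θ⟫ ≤ 0 ∧ fv' θ = reflect n (fv θ)) →
          (IsUnitNormal (C k) (fp θ + fs θ • fv θ) n ∧ ⟪n, fv θ⟫ ≤ 0 ∧
          fv' θ = reflect n (fv θ)) := fun θ => by
        by_cases hex : ∃ n, IsUnitNormal (C k) (fp θ + fs θ • fv θ) n ∧
          ⟪n, fv θ⟫ ≤ 0 ∧ fv' θ = reflect n (fv θ)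
        · exact ⟨hex.choose, fun _ => hex.choose_spec⟩
        · exact ⟨0, fun h => absurd h hex⟩
      choose fn hfn using hch
      have hfn' := hBk.mono fun θ hθ => hfn θ hθ
      have hsph : ∀ᶠ θ in (U : Filter Θ), fn θ ∈ Metric.sphere (0 : Plane) 1 :=
        hfn'.mono fun θ hθ => by simpa using hθ.1.norm_eq
      obtain ⟨n, hn, hlim⟩ := (isCompact_sphere (0 : Plane) 1).ultrafilter_le_nhds (U.map fn)
        (le_principal_iff.2 hsph)
      have hlim : Tendsto fn U (𝓝 n) := hlim
      have hn1 : ‖n‖ = 1 := by simpa using hn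
      refine ⟨k, n, ⟨⟨?_, ?_, ?_⟩, hn1⟩, ?_, ?_⟩
      · exact (hC.isClosed k).mem_of_tendsto ha (hfn'.mono fun θ hθ => hθ.1.mem)
      · rintro rfl; simp at hn1
      · intro y hy
        exact le_of_tendsto (hlim.inner (tendsto_const_nhds.sub ha))
          (hfn'.mono fun θ hθ => hθ.1.inner_le y hy)
      · exact le_of_tendsto (hlim.inner hv) (hfn'.mono fun θ hθ => hθ.2.1)
      · refine tendsto_nhds_unique hv' ?_
        have h1 : Tendsto (fun θ => reflect (fn θ) (fv θ)) U (𝓝 (reflect n v)) :=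
          hv.sub (((hlim.inner hv).const_mul 2).smul hlim)
        exact h1.congr' (hfn'.mono fun θ hθ => hθ.2.2.symm)

/-! ### Orbits -/

/-- A point outside the interiors of the regions, with a unit velocity. -/
structure State (C : ι → Set Plane) where
  pos : Plane
  vel : Plane
  free : Free C pos
  norm_eq : ‖vel‖ = 1

theorem exists_next (hC : IsScatterer C τ) (x : State C) :
    ∃ y : State C × ℝ, Step C τ x.pos x.vel y.2 y.1.pos y.1.vel := by
  obtain ⟨s, p', v', h⟩ := Step.exists_step hC x.free x.vel
  exact ⟨⟨⟨p', v', h.free hC x.norm_eq, h.norm_eq x.norm_eq⟩, s⟩, h⟩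

/-- The state after the time `τ`. -/
noncomputable def next (hC : IsScatterer C τ) (x : State C) : State C :=
  (exists_next hC x).choose.1

/-- The time of the possible reflection during the next time interval of length `τ`. -/
noncomputable def hitTime (hC : IsScatterer C τ) (x : State C) : ℝ :=
  (exists_next hC x).choose.2

theorem step_next (hC : IsScatterer C τ) (x : State C) :
    Step C τ x.pos x.vel (hitTime hC x) (next hC x).pos (next hC x).vel :=
  (exists_next hC x).choose_spec

/-- The velocities need not converge to that of the limit orbit: a reflection may fall just before
or just after a multiple of `τ`. The claim for them up to `VelocityEquiv` is what passes through the
induction, since a limit of steps is a step and steps from equivalent states end at the same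
position. -/
theorem exists_tendsto_iterate_next (hC : IsScatterer C τ) {Θ : Type*} {U : Ultrafilter Θ}
    {x : Θ → State C} {x₀ : State C} (hp : Tendsto (fun θ => (x θ).pos) U (𝓝 x₀.pos))
    (hv : Tendsto (fun θ => (x θ).vel) U (𝓝 x₀.vel)) (j : ℕ) :
    Tendsto (fun θ => ((next hC)^[j] (x θ)).pos) U (𝓝 ((next hC)^[j] x₀).pos) ∧
    ∃ w, Tendsto (fun θ => ((next hC)^[j] (x θ)).vel) U (𝓝 w) ∧
      VelocityEquiv C ((next hC)^[j] x₀).pos ((next hC)^[j] x₀).vel w := by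
  induction j with
  | zero => exact ⟨hp, x₀.vel, hv, Or.inl rfl⟩
  | succ j ih =>
    obtain ⟨h1, w, h2, h3⟩ := ih
    simp only [Function.iterate_succ_apply']
    have hstep := fun θ => step_next hC ((next hC)^[j] (x θ))
    obtain ⟨s, -, hs⟩ := (isCompact_Icc (a := (0 : ℝ)) (b := τ)).ultrafilter_le_nhds
      (U.map fun θ => hitTime hC ((next hC)^[j] (x θ)))
      (le_principal_iff.2 (mem_map.2 (univ_mem' fun θ => (hstep θ).mem_Icc)))
    obtain ⟨w', -, hw'⟩ := (isCompact_sphere (0 : Plane) 1).ultrafilter_le_nhds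
      (U.map fun θ => (next hC ((next hC)^[j] (x θ))).vel)
      (le_principal_iff.2 (mem_map.2 (univ_mem' fun θ => by
        simpa using (next hC ((next hC)^[j] (x θ))).norm_eq)))
    have hs : Tendsto (fun θ => hitTime hC ((next hC)^[j] (x θ))) U (𝓝 s) := hs
    have hw' : Tendsto (fun θ => (next hC ((next hC)^[j] (x θ))).vel) U (𝓝 w') := hw'
    have hpos : Tendsto (fun θ => (next hC ((next hC)^[j] (x θ))).pos) U
        (𝓝 (((next hC)^[j] x₀).pos + s • w + (τ - s) • w')) := by
      refine Tendsto.congr (fun θ => (hstep θ).eq_add.symm) ?_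
      exact (h1.add (hs.smul h2)).add ((tendsto_const_nhds.sub hs).smul hw')
    have hlim := step_of_tendsto hC h1 h2 hs hpos hw' hstep
    obtain ⟨e1, e2⟩ := (step_next hC ((next hC)^[j] x₀)).unique hC hlim
      ((next hC)^[j] x₀).norm_eq h3
    rw [← e1] at hpos
    exact ⟨hpos, w', hw', e2⟩

/-- Positions depend continuously on the initial state. -/
theorem continuous_iterate_next_pos (hC : IsScatterer C τ) {Θ : Type*} [TopologicalSpace Θ]
    {x : Θ → State C} (hp : Continuous fun θ => (x θ).pos) (hv : Continuous fun θ => (x θ).vel)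
    (j : ℕ) : Continuous fun θ => ((next hC)^[j] (x θ)).pos := by
  rw [continuous_iff_continuousAt]
  intro θ₀
  rw [ContinuousAt, tendsto_iff_ultrafilter]
  intro U hU
  exact (exists_tendsto_iterate_next hC ((hp.tendsto θ₀).mono_left hU)
    ((hv.tendsto θ₀).mono_left hU) j).1

end

/-! ### The curve of an orbit -/

section

variable {ι : Type*} {C : ι → Set Plane} {τ : ℝ} {p v w a V W : Plane} {s u t : ℝ}

theorem brokenPath_zero (hs : 0 ≤ s) : brokenPath p v s w 0 = p := by
  simp [brokenPath, hs]

theorem brokenPath_of_le (h : u ≤ s) : brokenPath p v s w u = p + u • v := by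
  rw [brokenPath, min_eq_left h, max_eq_right (by linarith), zero_smul, add_zero]

theorem brokenPath_of_ge (h : s ≤ u) : brokenPath p v s w u = p + s • v + (u - s) • w := by
  rw [brokenPath, min_eq_right h, max_eq_left (by linarith)]

theorem brokenPath_add {h : ℝ} (h0 : 0 ≤ h) (hs : u < s → u + h ≤ s) :
    brokenPath p v s w (u + h) = brokenPath p v s w u + h • (if u < s then v else w) := by
  split_ifs with hus
  · rw [brokenPath_of_le (hs hus), brokenPath_of_le hus.le]; module
  · rw [brokenPath_of_ge (by linarith), brokenPath_of_ge (not_lt.1 hus)]; module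

theorem brokenPath_sub {h : ℝ} (h0 : 0 ≤ h) (hs : s < u → s ≤ u - h) :
    brokenPath p v s w (u - h) = brokenPath p v s w u - h • (if u ≤ s then v else w) := by
  split_ifs with hus
  · rw [brokenPath_of_le (by linarith), brokenPath_of_le hus]; module
  · have hus := not_le.1 hus
    rw [brokenPath_of_ge (hs hus), brokenPath_of_ge hus.le]; module

/-- The `j`-th state of the orbit of `x`. -/
noncomputable def orbit (hC : IsScatterer C τ) (x : State C) (j : ℕ) : State C := (next hC)^[j] x

theorem orbit_succ (hC : IsScatterer C τ) (x : State C) (j : ℕ) :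
    orbit hC x (j + 1) = next hC (orbit hC x j) := Function.iterate_succ_apply' _ _ _

theorem step_orbit (hC : IsScatterer C τ) (x : State C) (j : ℕ) :
    Step C τ (orbit hC x j).pos (orbit hC x j).vel (hitTime hC (orbit hC x j))
      (orbit hC x (j + 1)).pos (orbit hC x (j + 1)).vel := by
  rw [orbit_succ]; exact step_next hC _

/-- The part of the motion between the times `j * τ` and `(j + 1) * τ`. -/
noncomputable def piece (hC : IsScatterer C τ) (x : State C) (j : ℕ) : ℝ → Plane :=
  brokenPath (orbit hC x j).pos (orbit hC x j).vel (hitTime hC (orbit hC x j))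
    (orbit hC x (j + 1)).vel

/-- The motion with initial state `x`. -/
noncomputable def curve (hC : IsScatterer C τ) (x : State C) (t : ℝ) : Plane :=
  piece hC x ⌊t / τ⌋₊ (t - ⌊t / τ⌋₊ * τ)

theorem piece_zero (hC : IsScatterer C τ) (x : State C) (j : ℕ) :
    piece hC x j 0 = (orbit hC x j).pos := brokenPath_zero (step_orbit hC x j).mem_Icc.1

theorem piece_end (hC : IsScatterer C τ) (x : State C) (j : ℕ) :
    piece hC x j τ = (orbit hC x (j + 1)).pos := (step_orbit hC x j).brokenPath_end

theorem floor_of_mem (hτ : 0 < τ) (j : ℕ) (hu : u ∈ Ico 0 τ) : ⌊(j * τ + u) / τ⌋₊ = j := by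
  rw [Nat.floor_eq_iff (div_nonneg (add_nonneg (by positivity) hu.1) hτ.le), le_div_iff₀ hτ,
    div_lt_iff₀ hτ]
  constructor <;> nlinarith [hu.1, hu.2]

theorem curve_eq_piece (hC : IsScatterer C τ) (x : State C) (j : ℕ) (hu : u ∈ Icc 0 τ) :
    curve hC x (j * τ + u) = piece hC x j u := by
  rcases hu.2.eq_or_lt with rfl | h
  · have e : (j : ℝ) * u + u = ((j + 1 : ℕ) : ℝ) * u + 0 := by push_cast; ring
    rw [curve, e, floor_of_mem hC.pos (j + 1) ⟨le_rfl, hC.pos⟩, add_sub_cancel_left, piece_zero,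
      piece_end]
  · rw [curve, floor_of_mem hC.pos j ⟨hu.1, h⟩, add_sub_cancel_left]

theorem exists_eq_mul_add (hτ : 0 < τ) (ht : 0 ≤ t) : ∃ (j : ℕ) (u : ℝ), u ∈ Ico 0 τ ∧
    t = j * τ + u := by
  refine ⟨⌊t / τ⌋₊, t - ⌊t / τ⌋₊ * τ, ⟨?_, ?_⟩, by ring⟩
  · have := Nat.floor_le (div_nonneg ht hτ.le)
    rw [le_div_iff₀ hτ] at this; linarith
  · have := Nat.lt_floor_add_one (t / τ)
    rw [div_lt_iff₀ hτ] at this; linarith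

theorem free_curve (hC : IsScatterer C τ) (x : State C) (ht : 0 ≤ t) : Free C (curve hC x t) := by
  obtain ⟨j, u, hu, rfl⟩ := exists_eq_mul_add hC.pos ht
  rw [curve_eq_piece hC x j ⟨hu.1, hu.2.le⟩]
  exact (step_orbit hC x j).free_brokenPath hC (orbit hC x j).norm_eq ⟨hu.1, hu.2.le⟩

theorem curve_hasVelocityAfter (hC : IsScatterer C τ) (x : State C) (j : ℕ) (hu : u ∈ Ico 0 τ) :
    HasVelocityAfter (curve hC x) (j * τ + u)
      (if u < hitTime hC (orbit hC x j) then (orbit hC x j).vel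
        else (orbit hC x (j + 1)).vel) := by
  set s := hitTime hC (orbit hC x j) with hs
  refine ⟨if u < s then min (s - u) (τ - u) else τ - u, ?_, fun h hh => ?_⟩
  · split_ifs with h
    · exact lt_min (by linarith) (by linarith [hu.2])
    · linarith [hu.2]
  · have h1 : u + h ≤ τ := by
      have := hh.2
      split_ifs at this
      · linarith [min_le_right (s - u) (τ - u)]
      · linarith
    have h2 : u < s → u + h ≤ s := fun hus => by
      have := hh.2
      rw [if_pos hus] at this
      linarith [min_le_left (s - u) (τ - u)]
    rw [add_assoc, curve_eq_piece hC x j ⟨by linarith [hu.1, hh.1], h1⟩,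
      curve_eq_piece hC x j ⟨hu.1, hu.2.le⟩]
    exact brokenPath_add hh.1 h2

theorem curve_hasVelocityBefore (hC : IsScatterer C τ) (x : State C) (j : ℕ) (hu : u ∈ Ioc 0 τ) :
    HasVelocityBefore (curve hC x) (j * τ + u)
      (if u ≤ hitTime hC (orbit hC x j) then (orbit hC x j).vel
        else (orbit hC x (j + 1)).vel) := by
  set s := hitTime hC (orbit hC x j) with hs
  have hs0 : 0 ≤ s := (step_orbit hC x j).mem_Icc.1
  refine ⟨if u ≤ s then u else u - s, ?_, fun h hh => ?_⟩
  · split_ifs with h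
    · exact hu.1
    · linarith
  · have h1 : 0 ≤ u - h := by
      have := hh.2
      split_ifs at this <;> linarith
    have h2 : s < u → s ≤ u - h := fun hus => by
      have := hh.2
      rw [if_neg (not_le.2 hus)] at this
      linarith
    rw [add_sub_assoc, curve_eq_piece hC x j ⟨h1, by linarith [hu.2, hh.1]⟩,
      curve_eq_piece hC x j ⟨hu.1.le, hu.2⟩]
    exact brokenPath_sub hh.1 h2

/-- An unchanged velocity at a boundary point must be tangent, as otherwise the curve would be
inside the region just before or just after; so it is its own reflection. -/
theorem reflect_or_of_eq_or_reflect (hC : IsScatterer C τ) (hp : Free C a) {ε : ℝ} (hε : 0 < ε)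
    (hV : ∀ u ∈ Ioc 0 ε, Free C (a - u • V)) (hW : ∀ u ∈ Ioc 0 ε, Free C (a + u • W))
    (h : W = V ∨ ∃ k n, IsUnitNormal (C k) a n ∧ W = reflect n V) :
    ((∀ k, a ∉ C k) ∧ W = V) ∨ ∃ k n, IsUnitNormal (C k) a n ∧ W = reflect n V := by
  rcases h with rfl | h
  · by_cases hk : ∀ k, a ∉ C k
    · exact Or.inl ⟨hk, rfl⟩
    · push Not at hk
      obtain ⟨k, hk⟩ := hk
      obtain ⟨n, hn⟩ := hC.exists_normal k a hk (hp k)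
      have h1 := hC.inner_nonneg_of_free hn.toIsNormal hε fun u hu => hW u hu k
      have h2 := hC.inner_nonneg_of_free hn.toIsNormal (v := -W) hε fun u hu => by
        rw [smul_neg, ← sub_eq_add_neg]; exact hV u hu k
      rw [inner_neg_right] at h2
      exact Or.inr ⟨k, n, hn, (reflect_eq_self (by linarith)).symm⟩
  · exact Or.inr h

theorem velocities_eq_or_reflect (hC : IsScatterer C τ) (x : State C) (ht : 0 < t) :
    ∃ V W, ‖V‖ = 1 ∧ ‖W‖ = 1 ∧ HasVelocityBefore (curve hC x) t V ∧
      HasVelocityAfter (curve hC x) t W ∧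
      (W = V ∨ ∃ k n, IsUnitNormal (C k) (curve hC x t) n ∧ W = reflect n V) := by
  have hnorm : ∀ j (P : Prop) [Decidable P],
      ‖if P then (orbit hC x j).vel else (orbit hC x (j + 1)).vel‖ = 1 := by
    intro j P _
    split_ifs
    · exact (orbit hC x j).norm_eq
    · exact (orbit hC x (j + 1)).norm_eq
  obtain ⟨j, u, hu, rfl⟩ := exists_eq_mul_add hC.pos ht.le
  have hlaw : ∀ i, (orbit hC x (i + 1)).vel = (orbit hC x i).vel ∨
      ∃ k n, IsUnitNormal (C k) ((orbit hC x i).pos + hitTime hC (orbit hC x i) •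
        (orbit hC x i).vel) n ∧ (orbit hC x (i + 1)).vel = reflect n (orbit hC x i).vel := by
    intro i
    rcases (step_orbit hC x i).law with h | ⟨k, n, h1, -, h2⟩
    · exact Or.inl h.1
    · exact Or.inr ⟨k, n, h1, h2⟩
  rcases hu.1.eq_or_lt with h0 | h0
  · obtain ⟨i, rfl⟩ : ∃ i, j = i + 1 := Nat.exists_eq_succ_of_ne_zero fun hj => by
      rw [hj, ← h0] at ht; simp at ht
    have e : ((i + 1 : ℕ) : ℝ) * τ + u = i * τ + τ := by rw [← h0]; push_cast; ring
    have hb := curve_hasVelocityBefore hC x i (u := τ) ⟨hC.pos, le_rfl⟩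
    rw [← e] at hb
    refine ⟨_, _, hnorm _ _, hnorm _ _, hb, curve_hasVelocityAfter hC x (i + 1) hu, ?_⟩
    rw [curve_eq_piece hC x (i + 1) ⟨hu.1, hu.2.le⟩, ← h0, piece_zero]
    set V := if τ ≤ hitTime hC (orbit hC x i) then (orbit hC x i).vel
      else (orbit hC x (i + 1)).vel with hV
    set W := if 0 < hitTime hC (orbit hC x (i + 1)) then (orbit hC x (i + 1)).vel
      else (orbit hC x (i + 1 + 1)).vel with hW
    have c1 : (orbit hC x (i + 1)).vel = V ∨ ∃ k n, IsUnitNormal (C k) (orbit hC x (i + 1)).pos n ∧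
        (orbit hC x (i + 1)).vel = reflect n V := by
      by_cases hc : τ ≤ hitTime hC (orbit hC x i)
      · have hst := (step_orbit hC x i).eq_add
        rw [le_antisymm (step_orbit hC x i).mem_Icc.2 hc, sub_self, zero_smul, add_zero] at hst
        have := hlaw i
        rw [le_antisymm (step_orbit hC x i).mem_Icc.2 hc, ← hst] at this
        rw [hV, if_pos hc]; exact this
      · rw [hV, if_neg hc]; exact Or.inl rfl
    have c2 : W = (orbit hC x (i + 1)).vel ∨
        ∃ k n, IsUnitNormal (C k) (orbit hC x (i + 1)).pos n ∧
        W = reflect n (orbit hC x (i + 1)).vel := by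
      by_cases hc : 0 < hitTime hC (orbit hC x (i + 1))
      · rw [hW, if_pos hc]; exact Or.inl rfl
      · have := hlaw (i + 1)
        rw [le_antisymm (not_lt.1 hc) (step_orbit hC x (i + 1)).mem_Icc.1, zero_smul,
          add_zero] at this
        rw [hW, if_neg hc]; exact this
    -- At a multiple of `τ` a reflection may be recorded both at the end of one step and at the
    -- start of the next. Both then use the same normal and cancel.
    rcases c1 with c1 | ⟨k, n, hn, c1⟩ <;> rcases c2 with c2 | ⟨l, m, hm, c2⟩
    · exact Or.inl (c2.trans c1)
    · exact Or.inr ⟨l, m, hm, by rw [c2, c1]⟩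
    · exact Or.inr ⟨k, n, hn, by rw [c2, c1]⟩
    · have hkl := hC.separated k l _ _ hn.mem hm.mem (by simpa using hC.pos.le)
      subst hkl
      have := hC.normal_unique hn hm
      subst this
      left; rw [c2, c1, reflect_reflect hn.norm_eq]
  · refine ⟨_, _, hnorm _ _, hnorm _ _, curve_hasVelocityBefore hC x j ⟨h0, hu.2.le⟩,
      curve_hasVelocityAfter hC x j hu, ?_⟩
    rcases lt_trichotomy u (hitTime hC (orbit hC x j)) with h | h | h
    · left; rw [if_pos h, if_pos h.le]
    · rw [if_neg h.not_lt, if_pos h.le, curve_eq_piece hC x j ⟨hu.1, hu.2.le⟩, piece,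
        brokenPath_of_le h.le]
      have := hlaw j
      rwa [← h] at this
    · left; rw [if_neg h.not_gt, if_neg (not_le.2 h)]

/-- The law of motion of the curve of an orbit. -/
theorem curve_law (hC : IsScatterer C τ) (x : State C) (ht : 0 < t) :
    ∃ V W, ‖V‖ = 1 ∧ ‖W‖ = 1 ∧ HasVelocityBefore (curve hC x) t V ∧
      HasVelocityAfter (curve hC x) t W ∧
      (((∀ k, curve hC x t ∉ C k) ∧ W = V) ∨
        ∃ k n, IsUnitNormal (C k) (curve hC x t) n ∧ W = reflect n V) := by
  obtain ⟨V, W, hV, hW, ⟨ε, hε, hb⟩, ⟨ε', hε', ha⟩, h⟩ := velocities_eq_or_reflect hC x ht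
  refine ⟨V, W, hV, hW, ⟨ε, hε, hb⟩, ⟨ε', hε', ha⟩, ?_⟩
  refine reflect_or_of_eq_or_reflect hC (free_curve hC x ht.le)
    (ε := min t (min ε ε')) (lt_min ht (lt_min hε hε')) (fun u hu => ?_) (fun u hu => ?_) h
  · rw [← hb u ⟨hu.1.le, hu.2.trans ((min_le_right _ _).trans (min_le_left _ _))⟩]
    exact free_curve hC x (by linarith [hu.2.trans (min_le_left _ _)])
  · rw [← ha u ⟨hu.1.le, hu.2.trans ((min_le_right _ _).trans (min_le_right _ _))⟩]
    exact free_curve hC x (by linarith [hu.1])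

theorem curve_zero_hasVelocityAfter (hC : IsScatterer C τ) (x : State C) :
    ∃ W, ‖W‖ = 1 ∧ HasVelocityAfter (curve hC x) 0 W := by
  have h := curve_hasVelocityAfter hC x 0 (u := 0) ⟨le_rfl, hC.pos⟩
  rw [Nat.cast_zero, zero_mul, add_zero] at h
  refine ⟨_, ?_, h⟩
  split_ifs
  · exact (orbit hC x 0).norm_eq
  · exact (orbit hC x (0 + 1)).norm_eq

end

/-! ### Unfolding the square -/

/-- The sign `(-1) ^ m`. -/
noncomputable def sign (m : ℤ) : ℝ := if Even m then 1 else -1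

theorem sign_mul_self (m : ℤ) : sign m * sign m = 1 := by
  rw [sign]; split_ifs <;> norm_num

theorem abs_sign (m : ℤ) : |sign m| = 1 := by
  rw [sign]; split_ifs <;> norm_num

theorem sign_succ (m : ℤ) : sign (m + 1) = - sign m := by
  rw [sign, sign]
  by_cases h : Even m
  · rw [if_pos h, if_neg (by simpa [Int.even_add_one] using h)]
  · rw [if_neg h, if_pos (by simpa [Int.even_add_one] using h), neg_neg]

/-- The folding of the line onto `[-1/2, 1/2]`. -/
noncomputable def foldLine (x : ℝ) : ℝ := sign (round x) * (x - round x)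

/-- At a half-integer the two adjacent cells give the same value, so the index need not be the one
chosen by `round`. -/
theorem foldLine_eq {x : ℝ} {k : ℤ} (h : |x - k| ≤ 1 / 2) : foldLine x = sign k * (x - k) := by
  have h1 : |x - round x| ≤ 1 / 2 := abs_sub_round x
  rw [foldLine]
  rw [abs_le] at h h1
  have h2 : (k : ℝ) - round x ≤ 1 := by linarith
  have h3 : (round x : ℝ) - k ≤ 1 := by linarith
  have h2' : k ≤ round x + 1 := by exact_mod_cast (by linarith : (k : ℝ) ≤ round x + 1)
  have h3' : round x ≤ k + 1 := by exact_mod_cast (by linarith : (round x : ℝ) ≤ k + 1)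
  rcases (by omega : round x = k ∨ round x = k + 1 ∨ k = round x + 1) with e | e | e
  · rw [e]
  · rw [e] at h1 ⊢
    rw [sign_succ]
    push_cast at h1 ⊢
    have : x = k + 1 / 2 := by linarith
    rw [this]; ring
  · rw [e] at h ⊢
    rw [sign_succ]
    push_cast at h ⊢
    have : x = round x + 1 / 2 := by linarith
    have h4 : x - round x = 1 / 2 := by linarith
    have h5 : x - (round x + 1) = -(1 / 2) := by linarith
    rw [h4, h5]; ring

/-- The folding of the plane onto the square. -/
noncomputable def fold (p : Plane) : Plane := WithLp.toLp 2 fun i => foldLine (p i)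

@[simp] theorem fold_apply (p : Plane) (i : Fin 2) : fold p i = foldLine (p i) := rfl

/-- The linear part of the folding on the cell with index `k`. -/
noncomputable def flip (k : Fin 2 → ℤ) (v : Plane) : Plane :=
  WithLp.toLp 2 fun i => sign (k i) * v i

@[simp] theorem flip_apply (k : Fin 2 → ℤ) (v : Plane) (i : Fin 2) :
    flip k v i = sign (k i) * v i := rfl

/-- The center of the cell with index `k`. -/
noncomputable def center (k : Fin 2 → ℤ) : Plane := WithLp.toLp 2 fun i => (k i : ℝ)

@[simp] theorem center_apply (k : Fin 2 → ℤ) (i : Fin 2) : center k i = k i := rfl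

theorem flip_flip (k : Fin 2 → ℤ) (v : Plane) : flip k (flip k v) = v := by
  ext i; simp only [flip_apply]; rw [← mul_assoc, sign_mul_self, one_mul]

theorem flip_add (k : Fin 2 → ℤ) (v w : Plane) : flip k (v + w) = flip k v + flip k w := by
  ext i; simp [mul_add]

theorem flip_sub (k : Fin 2 → ℤ) (v w : Plane) : flip k (v - w) = flip k v - flip k w := by
  ext i; simp [mul_sub]

theorem flip_smul (k : Fin 2 → ℤ) (c : ℝ) (v : Plane) : flip k (c • v) = c • flip k v := by
  ext i; simp [mul_left_comm]

theorem inner_flip_flip (k : Fin 2 → ℤ) (v w : Plane) : ⟪flip k v, flip k w⟫ = ⟪v, w⟫ := by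
  simp only [PiLp.inner_apply, flip_apply]
  refine Finset.sum_congr rfl fun i _ => ?_
  simp only [RCLike.inner_apply, conj_trivial]
  linear_combination (w i * v i) * sign_mul_self (k i)

theorem norm_flip (k : Fin 2 → ℤ) (v : Plane) : ‖flip k v‖ = ‖v‖ := by
  rw [@norm_eq_sqrt_real_inner _ _ _ (flip k v), inner_flip_flip, ← norm_eq_sqrt_real_inner]

theorem continuous_flip (k : Fin 2 → ℤ) : Continuous (flip k) := by
  unfold flip; fun_prop

theorem flip_reflect (k : Fin 2 → ℤ) (n v : Plane) :
    flip k (reflect n v) = reflect (flip k n) (flip k v) := by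
  rw [reflect, flip_sub, flip_smul, reflect, inner_flip_flip]

/-- The folding on the cell with index `k`, extended to the plane. -/
noncomputable def cellMap (k : Fin 2 → ℤ) : Plane ≃ₜ Plane where
  toFun p := flip k (p - center k)
  invFun q := flip k q + center k
  left_inv p := by simp [flip_flip]
  right_inv q := by simp [flip_flip]
  continuous_toFun := (continuous_flip k).comp (by fun_prop)
  continuous_invFun := (continuous_flip k).add continuous_const

theorem cellMap_apply (k : Fin 2 → ℤ) (p : Plane) : cellMap k p = flip k (p - center k) := rfl

theorem cellMap_add (k : Fin 2 → ℤ) (p v : Plane) : cellMap k (p + v) = cellMap k p + flip k v := by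
  rw [cellMap_apply, cellMap_apply, add_sub_right_comm, flip_add]

theorem cellMap_sub_cellMap (k : Fin 2 → ℤ) (p q : Plane) :
    cellMap k p - cellMap k q = flip k (p - q) := by
  rw [cellMap_apply, cellMap_apply, ← flip_sub, sub_sub_sub_cancel_right]

theorem fold_eq_cellMap {p : Plane} {k : Fin 2 → ℤ} (h : ∀ i, |p i - k i| ≤ 1 / 2) :
    fold p = cellMap k p := by
  ext i
  rw [fold_apply, foldLine_eq (h i), cellMap_apply]; simp

theorem fold_eq_cellMap_round (p : Plane) : fold p = cellMap (fun i => round (p i)) p :=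
  fold_eq_cellMap fun _ => abs_sub_round _

theorem fold_mem_square (p : Plane) : fold p ∈ square := fun i => by
  rw [fold_apply, foldLine, abs_mul, abs_sign, one_mul]
  exact abs_sub_round _

/-- The copies of the obstacle in the unfolded plane. -/
def copies (O : Set Plane) (k : Fin 2 → ℤ) : Set Plane := cellMap k ⁻¹' O

/-! ### Copies of the obstacle and folding of velocities -/

section

variable {O : Set Plane} {k l : Fin 2 → ℤ} {a n p u V W : Plane} {τ t T : ℝ}

theorem mem_copies : p ∈ copies O k ↔ cellMap k p ∈ O := Iff.rfl

theorem mem_interior_copies : p ∈ interior (copies O k) ↔ cellMap k p ∈ interior O := by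
  rw [copies, ← (cellMap k).preimage_interior]; rfl

theorem isNormal_copies : IsNormal (copies O k) a n ↔ IsNormal O (cellMap k a) (flip k n) := by
  have hne : flip k n ≠ 0 ↔ n ≠ 0 := by
    rw [← norm_ne_zero_iff, norm_flip, norm_ne_zero_iff]
  constructor
  · intro h
    refine ⟨h.mem, hne.2 h.ne_zero, fun y hy => ?_⟩
    obtain ⟨x, rfl⟩ := (cellMap k).surjective y
    rw [cellMap_sub_cellMap, inner_flip_flip]
    exact h.inner_le x hy
  · intro h
    refine ⟨h.mem, hne.1 h.ne_zero, fun y hy => ?_⟩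
    have := h.inner_le _ hy
    rwa [cellMap_sub_cellMap, inner_flip_flip] at this

theorem IsDefiningFunctionAt.isNormal {g : Plane → ℝ} (hO : Convex ℝ O)
    (hg : IsDefiningFunctionAt O p g) : IsNormal O p (gradient g p) := by
  refine ⟨hg.mem, hg.gradient_ne_zero, fun y hy => ?_⟩
  by_contra hcon
  push Not at hcon
  obtain ⟨t, ht1, ht2⟩ :=
    ((hg.eventually_notMem hcon).and (Ioc_mem_nhdsGT (zero_lt_one' ℝ))).exists
  exact ht1 (hO.add_smul_sub_mem hg.mem hy ⟨ht2.1.le, ht2.2⟩)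

/-- Copies with different indices lie in balls of radius `r` around lattice points at distance at
least 1, which gives the separation when `τ + 2 * r < 1`. Convexity makes every boundary normal a
supporting one. -/
theorem isScatterer_copies (hO : IsObstacle O) (hconv : Convex ℝ O) {r : ℝ}
    (hr : O ⊆ Metric.closedBall 0 r) (hτ : 0 < τ) (hτr : τ + 2 * r < 1) :
    IsScatterer (copies O) τ where
  pos := hτ
  isClosed k := hO.isCompact.isClosed.preimage (cellMap k).continuous
  exists_normal k a ha ha' := by
    rw [mem_interior_copies] at ha'
    obtain ⟨g, hg⟩ := hO.smooth_boundary (cellMap k a) ⟨subset_closure ha, ha'⟩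
    have hn := hg.isNormal hconv
    set m := flip k (gradient g (cellMap k a)) with hm
    have hm0 : 0 < ‖m‖ := by rw [hm, norm_flip]; exact norm_pos_iff.2 hn.ne_zero
    have h1 : IsNormal (copies O k) a m := by rw [isNormal_copies, hm, flip_flip]; exact hn
    refine ⟨‖m‖⁻¹ • m, ⟨h1.mem, ?_, fun y hy => ?_⟩, ?_⟩
    · exact smul_ne_zero (inv_ne_zero hm0.ne') h1.ne_zero
    · rw [real_inner_smul_left]
      exact mul_nonpos_of_nonneg_of_nonpos (by positivity) (h1.inner_le y hy)
    · rw [norm_smul, norm_inv, norm_norm, inv_mul_cancel₀ hm0.ne']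
  enter k a n u hn hu := by
    rw [isNormal_copies] at hn
    rw [← inner_flip_flip k] at hu
    filter_upwards [hn.eventually_mem_interior hO.smooth_boundary hu] with t ht
    rwa [mem_interior_copies, cellMap_add, flip_smul]
  separated k l x y hx hy hxy := by
    have hx := mem_closedBall_zero_iff.1 (hr (mem_copies.1 hx))
    have hy := mem_closedBall_zero_iff.1 (hr (mem_copies.1 hy))
    rw [cellMap_apply, norm_flip] at hx hy
    have h1 : ‖center k - center l‖ < 1 := by
      have e : center k - center l = -(x - center k) + (x - y) + (y - center l) := by abel
      rw [e]
      refine (norm_add_le _ _).trans_lt ?_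
      have := norm_add_le (-(x - center k)) (x - y)
      rw [norm_neg] at this
      linarith
    funext i
    have h2 := (PiLp.norm_apply_le (center k - center l) i).trans_lt h1
    simp only [PiLp.sub_apply, center_apply, Real.norm_eq_abs] at h2
    have h3 : |k i - l i| < 1 := by exact_mod_cast h2
    have := Int.abs_lt_one_iff.1 h3
    omega

theorem fold_notMem_interior (h : Free (copies O) p) : fold p ∉ interior O := by
  rw [fold_eq_cellMap_round]
  exact fun hp => h _ (mem_interior_copies.2 hp)

theorem fold_notMem (h : ∀ k, p ∉ copies O k) : fold p ∉ O := by
  rw [fold_eq_cellMap_round]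
  exact h _

/-- The index of the cell into which the coordinate `x` moves with velocity `v`. -/
noncomputable def cellIndex (x v : ℝ) : ℤ := if 0 ≤ v then ⌊x + 1 / 2⌋ else ⌈x - 1 / 2⌉

theorem cellIndex_bounds (x v : ℝ) : |x - cellIndex x v| ≤ 1 / 2 ∧
    (0 < v → x < cellIndex x v + 1 / 2) ∧ (v < 0 → cellIndex x v - 1 / 2 < x) := by
  rw [cellIndex]
  split_ifs with h
  · have h1 := Int.floor_le (x + 1 / 2)
    have h2 := Int.lt_floor_add_one (x + 1 / 2)
    exact ⟨abs_le.2 ⟨by linarith, by linarith⟩, fun _ => by linarith,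
      fun h' => absurd h (not_le.2 h')⟩
  · have h1 := Int.le_ceil (x - 1 / 2)
    have h2 := Int.ceil_lt_add_one (x - 1 / 2)
    exact ⟨abs_le.2 ⟨by linarith, by linarith⟩, fun h' => absurd h'.le h, fun _ => by linarith⟩

theorem exists_abs_add_mul_le (x v : ℝ) :
    ∃ ε > 0, ∀ s ∈ Icc 0 ε, |x + s * v - cellIndex x v| ≤ 1 / 2 := by
  obtain ⟨h1, h2, h3⟩ := cellIndex_bounds x v
  rw [abs_le] at h1
  rcases lt_trichotomy v 0 with hv | rfl | hv
  · refine ⟨(x - (cellIndex x v - 1 / 2)) / -v, div_pos (by linarith [h3 hv]) (by linarith),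
      fun s hs => ?_⟩
    have := (le_div_iff₀ (by linarith : 0 < -v)).1 hs.2
    exact abs_le.2 ⟨by linarith, by linarith [mul_nonpos_of_nonneg_of_nonpos hs.1 hv.le]⟩
  · exact ⟨1, one_pos, fun s _ => by rw [mul_zero, add_zero, abs_le]; exact h1⟩
  · refine ⟨(cellIndex x v + 1 / 2 - x) / v, div_pos (by linarith [h2 hv]) hv, fun s hs => ?_⟩
    have := (le_div_iff₀ hv).1 hs.2
    exact abs_le.2 ⟨by linarith [mul_nonneg hs.1 hv.le], by linarith⟩

/-- The index of the cell into which the point `p` moves with velocity `v`. -/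
noncomputable def cellAhead (p v : Plane) (i : Fin 2) : ℤ := cellIndex (p i) (v i)

theorem exists_fold_add_smul (p v : Plane) :
    ∃ ε > 0, ∀ s ∈ Icc (0 : ℝ) ε, fold (p + s • v) = fold p + s • flip (cellAhead p v) v := by
  choose ε hε h using fun i => exists_abs_add_mul_le (p i) (v i)
  refine ⟨min (ε 0) (ε 1), lt_min (hε 0) (hε 1), fun s hs => ?_⟩
  have hcell : ∀ s ∈ Icc (0 : ℝ) (min (ε 0) (ε 1)),
      ∀ i, |(p + s • v) i - cellAhead p v i| ≤ 1 / 2 := by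
    intro s hs i
    refine h i s ⟨hs.1, hs.2.trans ?_⟩
    fin_cases i
    · exact min_le_left _ _
    · exact min_le_right _ _
  have h0 := hcell 0 ⟨le_rfl, hs.1.trans hs.2⟩
  rw [zero_smul, add_zero] at h0
  rw [fold_eq_cellMap (hcell s hs), fold_eq_cellMap h0, cellMap_add, flip_smul]

theorem HasVelocityAfter.fold {Γ : ℝ → Plane} (h : HasVelocityAfter Γ t V) :
    HasVelocityAfter (fun t => fold (Γ t)) t (flip (cellAhead (Γ t) V) V) := by
  obtain ⟨ε, hε, h⟩ := h
  obtain ⟨δ, hδ, h'⟩ := exists_fold_add_smul (Γ t) V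
  refine ⟨min ε δ, lt_min hε hδ, fun s hs => ?_⟩
  simp only
  rw [h s ⟨hs.1, hs.2.trans (min_le_left _ _)⟩, h' s ⟨hs.1, hs.2.trans (min_le_right _ _)⟩]

theorem HasVelocityBefore.fold {Γ : ℝ → Plane} (h : HasVelocityBefore Γ t V) :
    HasVelocityBefore (fun t => fold (Γ t)) t (flip (cellAhead (Γ t) (-V)) V) := by
  obtain ⟨ε, hε, h⟩ := h
  obtain ⟨δ, hδ, h'⟩ := exists_fold_add_smul (Γ t) (-V)
  refine ⟨min ε δ, lt_min hε hδ, fun s hs => ?_⟩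
  simp only
  rw [h s ⟨hs.1, hs.2.trans (min_le_left _ _)⟩]
  have := h' s ⟨hs.1, hs.2.trans (min_le_right _ _)⟩
  rw [smul_neg, ← sub_eq_add_neg] at this
  rw [this]
  ext i; simp; ring

theorem abs_foldLine {x : ℝ} {k : ℤ} (h : |x - k| ≤ 1 / 2) : |foldLine x| = |x - k| := by
  rw [foldLine_eq h, abs_mul, abs_sign, one_mul]

/-- This is the law of reflection at the sides: the cell ahead and the cell behind are adjacent,
with opposite signs, exactly when the motion crosses a half-integer. If `v = 0`, both sides vanish.
-/
theorem sign_cellIndex_mul (x v : ℝ) : sign (cellIndex x v) * v =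
    if |foldLine x| = 1 / 2 then -(sign (cellIndex x (-v)) * v) else sign (cellIndex x (-v)) * v := by
  obtain ⟨a1, a2, a3⟩ := cellIndex_bounds x v
  obtain ⟨b1, b2, b3⟩ := cellIndex_bounds x (-v)
  set a := cellIndex x v
  set b := cellIndex x (-v)
  split_ifs with h
  · have ha := h; have hb := h
    rw [abs_foldLine a1, abs_eq (by norm_num)] at ha
    rw [abs_foldLine b1, abs_eq (by norm_num)] at hb
    rcases lt_trichotomy v 0 with hv | rfl | hv
    · have := a3 hv
      have := b2 (by linarith)
      have h1 : (b : ℝ) = a + 1 := by rcases ha with ha | ha <;> rcases hb with hb | hb <;> linarith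
      have h2 : b = a + 1 := by exact_mod_cast h1
      rw [h2, sign_succ]; ring
    · simp
    · have := a2 hv
      have := b3 (by linarith)
      have h1 : (a : ℝ) = b + 1 := by rcases ha with ha | ha <;> rcases hb with hb | hb <;> linarith
      have h2 : a = b + 1 := by exact_mod_cast h1
      rw [h2, sign_succ]; ring
  · have ha : |x - a| < 1 / 2 := lt_of_le_of_ne a1 (by rwa [← abs_foldLine a1])
    have hb : |x - b| < 1 / 2 := lt_of_le_of_ne b1 (by rwa [← abs_foldLine b1])
    rw [abs_lt] at ha hb
    have h1 : a < b + 1 := by exact_mod_cast (by linarith : (a : ℝ) < b + 1)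
    have h2 : b < a + 1 := by exact_mod_cast (by linarith : (b : ℝ) < a + 1)
    rw [(by omega : a = b)]

theorem cellIndex_eq {x v : ℝ} {k : ℤ} (h : |x - k| < 1 / 2) : cellIndex x v = k := by
  have h1 := (cellIndex_bounds x v).1
  rw [abs_lt] at h
  rw [abs_le] at h1
  have h2 : cellIndex x v < k + 1 := by exact_mod_cast (by linarith : (cellIndex x v : ℝ) < k + 1)
  have h3 : k < cellIndex x v + 1 := by exact_mod_cast (by linarith : (k : ℝ) < cellIndex x v + 1)
  omega

theorem reflect_eq_reflection {g : Plane} {c : ℝ} (hc : 0 < c) (hn : n = c • g) (hn1 : ‖n‖ = 1)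
    (v : Plane) : reflect n v = (ℝ ∙ g)ᗮ.reflection v := by
  have hspan : (ℝ ∙ g) = ℝ ∙ n := by
    rw [hn, Submodule.span_singleton_smul_eq (IsUnit.mk0 c hc.ne')]
  simp only [hspan]
  rw [Submodule.reflection_orthogonal_apply, Submodule.reflection_singleton_apply, hn1, reflect]
  simp only [RCLike.ofReal_real_eq_id, id_eq, one_pow, div_one, neg_sub]
  congr 1
  rw [mul_smul, ofNat_smul_eq_nsmul ℝ]

/-- The folded curve of an orbit is a billiard trajectory. -/
theorem isTrajectoryPiece_fold_curve (hO : IsObstacle O) (hC : IsScatterer (copies O) τ)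
    (x : State (copies O)) (hT : 0 < T) :
    IsTrajectoryPiece O T fun t => fold (curve hC x t) := by
  refine ⟨hT, fun t ht => ⟨fold_mem_square _, fold_notMem_interior (free_curve hC x ht.1)⟩,
    ?_, ?_, fun t ht => ?_⟩
  · obtain ⟨W, hW, h⟩ := curve_zero_hasVelocityAfter hC x
    exact ⟨_, by rw [norm_flip]; exact hW, h.fold⟩
  · obtain ⟨V, W, hV, -, h, -⟩ := curve_law hC x hT
    exact ⟨_, by rw [norm_flip]; exact hV, h.fold⟩
  · obtain ⟨V, W, hV, hW, hb, ha, hlaw⟩ := curve_law hC x ht.1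
    refine ⟨_, _, by rw [norm_flip]; exact hV, by rw [norm_flip]; exact hW, hb.fold, ha.fold, ?_⟩
    rcases hlaw with ⟨hnot, rfl⟩ | ⟨k, n, hn, rfl⟩
    · exact Or.inl ⟨fold_notMem hnot, fun i => sign_cellIndex_mul _ _⟩
    · right
      set p := curve hC x t
      have hN := isNormal_copies.1 hn.toIsNormal
      -- A hit occurs strictly inside a cell, so the folding is a single isometry around it and no
      -- side interferes.
      have hlt : ∀ i, |p i - k i| < 1 / 2 := fun i => by
        have := hO.coord_lt hN.mem i
        rwa [cellMap_apply, flip_apply, abs_mul, abs_sign, one_mul] at this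
      have hcell : ∀ v, cellAhead p v = k := fun v => funext fun i => cellIndex_eq (hlt i)
      have hfold : fold p = cellMap k p := fold_eq_cellMap fun i => (hlt i).le
      obtain ⟨g, hg⟩ := hO.smooth_boundary _ hN.mem_frontier
      obtain ⟨c, hc, hcg⟩ := hN.exists_eq_smul_gradient hg
      simp only [hcell, hfold]
      refine ⟨hN.mem, g, hg, ?_⟩
      rw [flip_reflect]
      exact reflect_eq_reflection hc hcg (by rw [norm_flip, hn.norm_eq]) _

end

/-! ### Displacement as a sum of angles -/

/-- The argument, in turns, of the quotient of two vectors. -/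
noncomputable def angleBetween (p q : Plane) : ℝ :=
  Complex.arg (toComplex q / toComplex p) / (2 * Real.pi)

theorem HasAngle.add_angleBetween {p q : Plane} {θ : ℝ} (hp : p ≠ 0) (hq : q ≠ 0)
    (h : HasAngle p θ) : HasAngle q (θ + angleBetween p q) := by
  rw [hasAngle_iff_of_mul (p := q) (q := p)
    (div_ne_zero (toComplex_ne_zero hq) (toComplex_ne_zero hp))
    (by rw [mul_div_cancel₀ _ (toComplex_ne_zero hp)])]
  simpa [angleBetween] using h

theorem exists_hasAngle (p : Plane) : ∃ θ, HasAngle p θ := by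
  refine ⟨Complex.arg (toComplex p) / (2 * Real.pi), ?_⟩
  rw [hasAngle_iff, ← norm_toComplex, turn_arg]

/-- The quotient differs from 1 by less than 1, so its real part is positive. -/
theorem div_mem_slitPlane {p q : Plane} (hpq : ‖q - p‖ < ‖p‖) :
    toComplex q / toComplex p ∈ Complex.slitPlane := by
  have hp : p ≠ 0 := fun h => by simp [h] at hpq; exact absurd hpq (not_lt.2 (norm_nonneg q))
  have hp' := toComplex_ne_zero hp
  have e : toComplex q / toComplex p = 1 + toComplex (q - p) / toComplex p := by
    rw [toComplex_sub]; field_simp; ring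
  have h1 : ‖toComplex (q - p) / toComplex p‖ < 1 := by
    rw [norm_div, norm_toComplex, norm_toComplex, div_lt_one (norm_pos_iff.2 hp)]; exact hpq
  left
  rw [e, Complex.add_re, Complex.one_re]
  have := (abs_le.1 (Complex.abs_re_le_norm (toComplex (q - p) / toComplex p))).1
  linarith

theorem ne_zero_of_norm_sub_lt {p q : Plane} (hpq : ‖q - p‖ < ‖p‖) : p ≠ 0 ∧ q ≠ 0 := by
  constructor
  · rintro rfl; rw [norm_zero] at hpq; exact absurd hpq (not_lt.2 (norm_nonneg _))
  · rintro rfl; rw [zero_sub, norm_neg] at hpq; exact lt_irrefl _ hpq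

theorem ContinuousOn.angleBetween {X : Type*} [TopologicalSpace X] {f g : X → Plane} {S : Set X}
    (hf : ContinuousOn f S) (hg : ContinuousOn g S) (h : ∀ x ∈ S, ‖g x - f x‖ < ‖f x‖) :
    ContinuousOn (fun x => SquareBilliard.angleBetween (f x) (g x)) S := by
  intro x hx
  refine ContinuousWithinAt.div_const ?_ _
  refine (Complex.continuousAt_arg (div_mem_slitPlane (h x hx))).comp_continuousWithinAt
    (f := fun x => toComplex (g x) / toComplex (f x)) ?_
  exact (continuous_toComplex.continuousAt.comp_continuousWithinAt (hg x hx)).div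
    (continuous_toComplex.continuousAt.comp_continuousWithinAt (hf x hx))
    (toComplex_ne_zero (ne_zero_of_norm_sub_lt (h x hx)).1)

/-- The sum of the angles between the first `N + 1` consecutive vectors of a sequence. -/
noncomputable def angleSum (P : ℕ → Plane) (N : ℕ) : ℝ :=
  ∑ j ∈ Finset.range N, angleBetween (P j) (P (j + 1))

/-- During one step the vector from `z` moves by less than its initial length, so the principal
argument of the quotient is a continuous branch there; the branches are glued at the multiples of
`τ`. -/
theorem exists_isDisplacement_angleSum {γ : ℝ → Plane} {z : Plane} {τ : ℝ} (hτ : 0 < τ) (N : ℕ)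
    (hγ : ContinuousOn γ (Icc 0 (N * τ)))
    (hz : ∀ j < N, ∀ t ∈ Icc (j * τ) ((j + 1 : ℕ) * τ), ‖γ t - γ (j * τ)‖ < ‖γ (j * τ) - z‖) :
    IsDisplacement z γ (N * τ) (angleSum (fun j => γ (j * τ) - z) N) := by
  induction N with
  | zero =>
    obtain ⟨θ, hθ⟩ := exists_hasAngle (γ 0 - z)
    refine ⟨fun _ => θ, continuousOn_const, fun t ht => ?_, by simp [angleSum]⟩
    have : t = 0 := by simpa using ht
    rw [this]; exact hθ
  | succ N ih =>
    have e : ((N + 1 : ℕ) : ℝ) * τ = N * τ + τ := by push_cast; ring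
    have h0 : 0 ≤ (N : ℝ) * τ := by positivity
    have hle : (N : ℝ) * τ ≤ ((N + 1 : ℕ) : ℝ) * τ := by rw [e]; linarith
    obtain ⟨φ, hφ, hφ', hd⟩ := ih (hγ.mono (Icc_subset_Icc_right hle))
      fun j hj => hz j (hj.trans (Nat.lt_succ_self N))
    have hz' := hz N (Nat.lt_succ_self N)
    have hsub : ∀ t, γ t - z - (γ (N * τ) - z) = γ t - γ (N * τ) := fun t => by abel
    set ψ : ℝ → ℝ := fun t => φ (N * τ) + angleBetween (γ (N * τ) - z) (γ t - z) with hψ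
    have hψc : ContinuousOn ψ (Icc (N * τ) ((N + 1 : ℕ) * τ)) := by
      refine continuousOn_const.add (ContinuousOn.angleBetween continuousOn_const
        ((hγ.mono (Icc_subset_Icc_left h0)).sub continuousOn_const) fun t ht => ?_)
      rw [hsub]; exact hz' t ht
    have hne := ne_zero_of_norm_sub_lt (p := γ (N * τ) - z) (q := γ (N * τ) - z)
      (by rw [hsub]; exact hz' _ ⟨le_rfl, hle⟩)
    have hψ0 : ψ (N * τ) = φ (N * τ) := by
      simp [hψ, angleBetween, div_self (toComplex_ne_zero hne.1)]
    set χ : ℝ → ℝ := fun t => if t ≤ N * τ then φ t else ψ t with hχ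
    have hχ1 : EqOn χ φ (Icc 0 (N * τ)) := fun t ht => if_pos ht.2
    have hχ2 : EqOn χ ψ (Icc (N * τ) ((N + 1 : ℕ) * τ)) := fun t ht => by
      rcases ht.1.eq_or_lt with h | h
      · rw [← h, hψ0]; exact if_pos le_rfl
      · exact if_neg (not_le.2 h)
    refine ⟨χ, ?_, fun t ht => ?_, ?_⟩
    · rw [← Icc_union_Icc_eq_Icc h0 hle]
      exact (hφ.congr hχ1).union_of_isClosed (hψc.congr hχ2) isClosed_Icc isClosed_Icc
    · change HasAngle (γ t - z) (χ t)
      rcases le_total t (N * τ) with h | h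
      · rw [hχ1 ⟨ht.1, h⟩]; exact hφ' t ⟨ht.1, h⟩
      · rw [hχ2 ⟨h, ht.2⟩]
        have hq := (ne_zero_of_norm_sub_lt (p := γ (N * τ) - z) (q := γ t - z)
          (by rw [hsub]; exact hz' _ ⟨h, ht.2⟩)).2
        have hb : HasAngle (γ (N * τ) - z) (φ (N * τ)) := hφ' _ ⟨h0, le_rfl⟩
        exact hb.add_angleBetween hne.1 hq
    · rw [hχ2 ⟨hle, le_rfl⟩, hχ1 ⟨le_rfl, h0⟩, hψ, angleSum, Finset.sum_range_succ]
      rw [angleSum] at hd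
      rw [hd]; ring

theorem HasAngle.add_angleSum {P : ℕ → Plane} (hP : ∀ j, P j ≠ 0) {θ : ℝ} (h : HasAngle (P 0) θ)
    (N : ℕ) : HasAngle (P N) (θ + angleSum P N) := by
  induction N with
  | zero => simpa [angleSum] using h
  | succ N ih =>
    rw [angleSum, Finset.sum_range_succ, ← add_assoc]
    exact ih.add_angleBetween (hP N) (hP (N + 1))

theorem exists_int_eq_of_hasAngle {p : Plane} (hp : p ≠ 0) {θ S : ℝ} (h : HasAngle p θ)
    (h' : HasAngle p (θ + S)) : ∃ m : ℤ, S = m := by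
  rw [hasAngle_iff] at h h'
  rw [turn_add, ← mul_assoc, ← h] at h'
  have h1 : turn S = 1 := mul_left_cancel₀ (toComplex_ne_zero hp) (by rw [mul_one]; exact h'.symm)
  rw [turn, Complex.exp_eq_one_iff] at h1
  obtain ⟨m, hm⟩ := h1
  refine ⟨m, ?_⟩
  have h2 := congrArg Complex.im hm
  simp at h2
  have h3 : (2 * Real.pi) * S = (2 * Real.pi) * m := by linarith
  exact mul_left_cancel₀ Real.two_pi_pos.ne' h3

theorem angleSum_mul {P : ℕ → Plane} {L : ℕ} (hP : ∀ j, P (j + L) = P j) (n : ℕ) :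
    angleSum P (n * L) = n * angleSum P L := by
  have hP' : ∀ n j, P (n * L + j) = P j := by
    intro n j
    induction n with
    | zero => simp
    | succ n ih => rw [Nat.succ_mul, add_right_comm, hP, ih]
  induction n with
  | zero => simp [angleSum]
  | succ n ih =>
    have : angleSum P (n * L + L) = angleSum P (n * L) + angleSum P L := by
      rw [angleSum, Finset.sum_range_add]
      congr 1
      refine Finset.sum_congr rfl fun j _ => ?_
      rw [add_assoc, hP', hP']
    rw [Nat.succ_mul, this, ih]; push_cast; ring

/-- A closed polygon all of whose vertices follow each other in the same direction makes
at least one full turn. -/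
theorem le_mul_angleSum {P : ℕ → Plane} {L : ℕ} (hL : 0 < L) (hP : ∀ j, P (j + L) = P j)
    (hP0 : ∀ j, P j ≠ 0) {σ : ℝ} (hσ : σ = 1 ∨ σ = -1)
    (hcross : ∀ j, 0 < σ * (P j 0 * P (j + 1) 1 - P j 1 * P (j + 1) 0)) (n : ℕ) :
    n ≤ σ * angleSum P (n * L) := by
  have hpos : 0 < σ * angleSum P L := by
    rw [angleSum, Finset.mul_sum]
    refine Finset.sum_pos (fun j _ => ?_) (Finset.nonempty_range_iff.2 hL.ne')
    have him : (toComplex (P (j + 1)) / toComplex (P j)).im =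
        (P j 0 * P (j + 1) 1 - P j 1 * P (j + 1) 0) / Complex.normSq (toComplex (P j)) := by
      rw [Complex.div_im]; simp; ring
    have hN := Complex.normSq_pos.2 (toComplex_ne_zero (hP0 j))
    have hc := hcross j
    rw [angleBetween, ← mul_div_assoc]
    refine div_pos ?_ Real.two_pi_pos
    rcases hσ with rfl | rfl
    · rw [one_mul] at hc ⊢
      refine lt_of_le_of_ne (Complex.arg_nonneg_iff.2 ?_) fun h0 => ?_
      · rw [him]; positivity
      · have := (Complex.arg_eq_zero_iff.1 h0.symm).2
        rw [him] at this
        exact (div_pos hc hN).ne' this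
    · rw [neg_one_mul, neg_pos] at hc ⊢
      rw [Complex.arg_neg_iff, him]
      exact div_neg_of_neg_of_pos hc hN
  obtain ⟨θ, hθ⟩ := exists_hasAngle (P 0)
  have h1 := hθ.add_angleSum hP0 L
  have h2 := hP 0
  rw [zero_add] at h2
  rw [h2] at h1
  -- The polygon is closed, so the sum over a period is an integer; being positive after
  -- multiplication by `σ`, it is at least 1 in that sense.
  obtain ⟨m, hm⟩ := exists_int_eq_of_hasAngle (hP0 0) hθ h1
  have h3 : 1 ≤ σ * angleSum P L := by
    rw [hm] at hpos ⊢
    rcases hσ with rfl | rfl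
    · rw [one_mul] at hpos ⊢; exact_mod_cast hpos
    · have : (0 : ℝ) < ((-m : ℤ) : ℝ) := by push_cast; linarith
      have h4 : (0 : ℤ) < -m := by exact_mod_cast this
      have h5 : ((1 : ℤ) : ℝ) ≤ ((-m : ℤ) : ℝ) := by exact_mod_cast h4
      push_cast at h5; linarith
  rw [angleSum_mul hP]
  nlinarith [(Nat.cast_nonneg n : (0 : ℝ) ≤ n)]

/-! ### Trajectories that start at the midpoint of the lower side -/

section

variable {O : Set Plane} {τ r : ℝ} {p v : Plane}

theorem free_of_forall_lt_norm (hr : O ⊆ Metric.closedBall 0 r)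
    (h : ∀ k, r < ‖p - center k‖) (k : Fin 2 → ℤ) : p ∉ copies O k := fun hp => by
  have := mem_closedBall_zero_iff.1 (hr (mem_copies.1 hp))
  rw [cellMap_apply, norm_flip] at this
  exact absurd this (not_le.2 (h k))

/-- An orbit on a line that avoids all regions. -/
theorem orbit_eq_of_forall_notMem {ι : Type*} {C : ι → Set Plane} (hC : IsScatterer C τ)
    (x : State C) (h : ∀ t : ℝ, 0 ≤ t → ∀ k, x.pos + t • x.vel ∉ C k) (j : ℕ) :
    (orbit hC x j).pos = x.pos + (j * τ) • x.vel ∧ (orbit hC x j).vel = x.vel := by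
  induction j with
  | zero => simp [orbit]
  | succ j ih =>
    have hτ := hC.pos
    have hs := step_orbit hC x j
    rw [ih.1, ih.2] at hs
    have hst : Step C τ (x.pos + (j * τ) • x.vel) x.vel 0 (x.pos + ((j + 1 : ℕ) * τ) • x.vel)
        x.vel := by
      refine ⟨⟨le_rfl, hτ.le⟩, by push_cast; module, Or.inl ⟨rfl, fun u hu k hk => ?_⟩⟩
      rw [add_assoc, ← add_smul] at hk
      exact h (j * τ + u) (add_nonneg (by positivity) hu.1) k (interior_subset hk)
    obtain ⟨h1, h2⟩ := hst.unique_of_same hC hs x.norm_eq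
    refine ⟨h1.symm, ?_⟩
    rcases h2 with h2 | ⟨k, n, hn, -⟩
    · exact h2.symm
    · exact absurd hn.mem (h (((j + 1 : ℕ) : ℝ) * τ) (by positivity) k)

/-- The midpoint of the lower side of the square. -/
noncomputable def bottom : Plane := !₂[0, -(1 / 2)]

theorem lt_norm_bottom_sub_center (hr : r < √2 / 4) (k : Fin 2 → ℤ) : r < ‖bottom - center k‖ := by
  have h1 : ‖(bottom - center k) 1‖ ≤ ‖bottom - center k‖ := PiLp.norm_apply_le _ 1
  have h2 : 1 / 2 ≤ ‖(bottom - center k) 1‖ := by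
    have e : bottom 1 = -(1 / 2) := rfl
    rw [PiLp.sub_apply, center_apply, Real.norm_eq_abs, e]
    rcases le_or_gt 0 (k 1) with h | h
    · have : (0 : ℝ) ≤ k 1 := by exact_mod_cast h
      rw [abs_of_neg (by linarith)]; linarith
    · have : (k 1 : ℝ) ≤ -1 := by exact_mod_cast (by omega : k 1 ≤ -1)
      rw [abs_of_nonneg (by linarith)]; linarith
  have h3 : √2 ≤ 3 / 2 := by rw [Real.sqrt_le_left (by norm_num)]; norm_num
  linarith

theorem sub_sq_le_two_mul (v : Plane) {σ : ℝ} (hσ : σ = 1 ∨ σ = -1) :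
    |v 0 - σ * v 1| ≤ √2 * ‖v‖ := by
  refine le_trans ?_ (abs_add_abs_le_sqrt_two v)
  refine (abs_sub _ _).trans_eq ?_
  rcases hσ with rfl | rfl <;> simp

/-- A point of the line `x - σ y = σ / 2` is far from the lattice points. -/
theorem lt_norm_sub_center (hr : r < √2 / 4) {σ : ℝ} (hσ : σ = 1 ∨ σ = -1)
    (hp : p 0 - σ * p 1 = σ / 2) (k : Fin 2 → ℤ) : r < ‖p - center k‖ := by
  have h1 := sub_sq_le_two_mul (p - center k) hσ
  have e : (p - center k) 0 - σ * (p - center k) 1 = σ / 2 - (k 0 - σ * k 1) := by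
    simp only [PiLp.sub_apply, center_apply]; linear_combination hp
  rw [e] at h1
  -- A half-integer has absolute value at least `1/2`; thus the distance from the line to every
  -- lattice point is at least `1 / (2 * √2) = √2 / 4`.
  have h2 : 1 / 2 ≤ |σ / 2 - (k 0 - σ * k 1)| := by
    obtain ⟨m, hm⟩ : ∃ m : ℤ, σ / 2 - (k 0 - σ * k 1) = 1 / 2 + m := by
      rcases hσ with rfl | rfl
      · exact ⟨k 1 - k 0, by push_cast; ring⟩
      · exact ⟨-1 - k 0 - k 1, by push_cast; ring⟩
    rw [hm]
    rcases le_or_gt 0 m with h | h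
    · have : (0 : ℝ) ≤ m := by exact_mod_cast h
      rw [abs_of_nonneg (by linarith)]; linarith
    · have : (m : ℝ) ≤ -1 := by exact_mod_cast (by omega : m ≤ -1)
      rw [abs_of_neg (by linarith)]; linarith
  have h3 : √2 * √2 = 2 := Real.mul_self_sqrt (by norm_num)
  have h4 : 0 < √2 := by positivity
  by_contra hcon
  push Not at hcon
  have : √2 * ‖p - center k‖ ≤ √2 * r := mul_le_mul_of_nonneg_left hcon h4.le
  nlinarith

/-- The points of the orbit with direction `(σ, 1)` at equal time intervals, `M` of which
make up a side of the diamond. -/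
noncomputable def diamondPoint (σ : ℝ) (M j : ℕ) : Plane :=
  !₂[σ * (j / (2 * M)), -(1 / 2) + j / (2 * M)]

theorem diamondPoint_zero (σ : ℝ) (M j : ℕ) : diamondPoint σ M j 0 = σ * (j / (2 * M)) := rfl

theorem diamondPoint_one (σ : ℝ) (M j : ℕ) :
    diamondPoint σ M j 1 = -(1 / 2) + j / (2 * M) := rfl

theorem sign_neg (m : ℤ) : sign (-m) = sign m := by simp [sign]

/-- The folding is the triangular wave `arcsin (sin (π x)) / π`. -/
theorem continuous_foldLine : Continuous foldLine := by
  have h : foldLine = fun x => Real.arcsin (Real.sin (Real.pi * x)) / Real.pi := by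
    funext x
    have hy := abs_le.1 (abs_sub_round x)
    have hpi := Real.pi_pos
    rw [foldLine]
    set k := round x
    set y := x - k with hyd
    have e : Real.pi * x = Real.pi * y + k * Real.pi := by rw [hyd]; ring
    have hs : Real.sin (Real.pi * x) = Real.sin (sign k * (Real.pi * y)) := by
      rw [e, Real.sin_add_int_mul_pi, sign]
      split_ifs with h
      · rw [h.neg_one_zpow, one_mul, one_mul]
      · rw [(Int.not_even_iff_odd.1 h).neg_one_zpow, neg_one_mul, neg_one_mul, Real.sin_neg]
    have h1 : -(Real.pi / 2) ≤ Real.pi * y := by nlinarith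
    have h2 : Real.pi * y ≤ Real.pi / 2 := by nlinarith
    have h3 : -(Real.pi / 2) ≤ sign k * (Real.pi * y) ∧ sign k * (Real.pi * y) ≤ Real.pi / 2 := by
      rw [sign]; split_ifs <;> constructor <;> linarith
    rw [hs, Real.arcsin_sin h3.1 h3.2]
    field_simp
  rw [h]
  exact (Real.continuous_arcsin.comp (by fun_prop)).div_const _

theorem continuous_fold : Continuous fold := by
  have := continuous_foldLine
  unfold fold
  fun_prop

theorem foldLine_add_two (x : ℝ) {σ : ℝ} (hσ : σ = 1 ∨ σ = -1) :
    foldLine (x + 2 * σ) = foldLine x := by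
  have hs : ∀ m : ℤ, sign (m + 2) = sign m := fun m => by
    rw [show m + 2 = m + 1 + 1 by ring, sign_succ, sign_succ, neg_neg]
  have key : ∀ y : ℝ, foldLine (y + 2) = foldLine y := fun y => by
    have h := abs_sub_round y
    rw [foldLine_eq (x := y + 2) (k := round y + 2) (by
      push_cast; rwa [add_sub_add_right_eq_sub]), hs, foldLine]
    push_cast; ring
  rcases hσ with rfl | rfl
  · rw [mul_one, key]
  · rw [← key (x + 2 * -1)]; congr 1; ring

theorem fold_diamondPoint_add {σ : ℝ} (hσ : σ = 1 ∨ σ = -1) {M : ℕ} (hM : 0 < M) (j : ℕ) :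
    fold (diamondPoint σ M (j + 4 * M)) = fold (diamondPoint σ M j) := by
  have hM' : (M : ℝ) ≠ 0 := by positivity
  have e : ((j + 4 * M : ℕ) : ℝ) / (2 * M) = j / (2 * M) + 2 := by
    push_cast; field_simp; ring
  ext i
  rw [fold_apply, fold_apply]
  fin_cases i
  · change foldLine (diamondPoint σ M (j + 4 * M) 0) = foldLine (diamondPoint σ M j 0)
    rw [diamondPoint_zero, diamondPoint_zero, e, mul_add, mul_comm σ 2, foldLine_add_two _ hσ]
  · change foldLine (diamondPoint σ M (j + 4 * M) 1) = foldLine (diamondPoint σ M j 1)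
    rw [diamondPoint_one, diamondPoint_one, e, ← add_assoc]
    simpa using foldLine_add_two (-(1 / 2) + j / (2 * M)) (Or.inl rfl)

/-- Consecutive points are in a common cell. -/
theorem exists_cell_diamondPoint {σ : ℝ} (hσ : σ = 1 ∨ σ = -1) {M : ℕ} (hM : 0 < M) (j : ℕ) :
    ∃ k : Fin 2 → ℤ, (∀ i, |diamondPoint σ M j i - k i| ≤ 1 / 2) ∧
      ∀ i, |diamondPoint σ M (j + 1) i - k i| ≤ 1 / 2 := by
  have hM' : (0 : ℝ) < M := by positivity
  have key : ∀ a : ℕ, ∃ k : ℕ, ∀ b : ℕ, b = a ∨ b = a + 1 →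
      (k : ℝ) ≤ b / (2 * M) ∧ (b : ℝ) / (2 * M) ≤ k + 1 := by
    intro a
    refine ⟨a / (2 * M), fun b hb => ?_⟩
    have h1 : a / (2 * M) * (2 * M) ≤ a := Nat.div_mul_le_self a (2 * M)
    have h2 : a < a / (2 * M) * (2 * M) + 2 * M := Nat.lt_div_mul_add (by positivity)
    have h3 : a / (2 * M) * (2 * M) ≤ b := by omega
    have h4 : b ≤ a / (2 * M) * (2 * M) + 2 * M := by omega
    rw [le_div_iff₀ (by positivity), div_le_iff₀ (by positivity)]
    have h5 : ((a / (2 * M) : ℕ) : ℝ) * (2 * M) ≤ b := by exact_mod_cast h3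
    have h6 : (b : ℝ) ≤ ((a / (2 * M) : ℕ) : ℝ) * (2 * M) + 2 * M := by exact_mod_cast h4
    exact ⟨h5, by linarith⟩
  -- The first coordinate starts in the middle of a cell, the second at its lower edge; half a cell
  -- is `M` points, hence the shift.
  obtain ⟨k₀, h0⟩ := key (j + M)
  obtain ⟨k₁, h1⟩ := key j
  have hshift : ∀ b : ℕ, ((b + M : ℕ) : ℝ) / (2 * M) = b / (2 * M) + 1 / 2 := fun b => by
    push_cast; field_simp
  have ha : ∀ b : ℕ, b = j ∨ b = j + 1 → |σ * ((b : ℝ) / (2 * M)) - σ * k₀| ≤ 1 / 2 ∧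
      |-(1 / 2) + (b : ℝ) / (2 * M) - k₁| ≤ 1 / 2 := by
    intro b hb
    have e0 := h0 (b + M) (by omega)
    have e1 := h1 b hb
    rw [hshift] at e0
    constructor
    · have hs : |σ| = 1 := by rcases hσ with rfl | rfl <;> simp
      rw [← mul_sub, abs_mul, hs, one_mul, abs_le]
      constructor <;> linarith
    · rw [abs_le]; constructor <;> linarith
  obtain ⟨m, hm⟩ : ∃ m : ℤ, (m : ℝ) = σ * k₀ := by
    rcases hσ with rfl | rfl
    · exact ⟨k₀, by simp⟩
    · exact ⟨-k₀, by simp⟩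
  rw [← hm] at ha
  refine ⟨![m, k₁], fun i => ?_, fun i => ?_⟩
  · fin_cases i
    · simpa [diamondPoint] using (ha j (Or.inl rfl)).1
    · simpa [diamondPoint] using (ha j (Or.inl rfl)).2
  · fin_cases i
    · simpa [diamondPoint] using (ha (j + 1) (Or.inr rfl)).1
    · simpa [diamondPoint] using (ha (j + 1) (Or.inr rfl)).2

/-- The folded orbit turns around each point close to the center of the square. -/
theorem cross_fold_diamondPoint {σ : ℝ} (hσ : σ = 1 ∨ σ = -1) {M : ℕ} (hM : 0 < M) (j : ℕ)
    {z : Plane} (hz : ‖z‖ < √2 / 4) :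
    0 < σ * ((fold (diamondPoint σ M j) - z) 0 * (fold (diamondPoint σ M (j + 1)) - z) 1 -
      (fold (diamondPoint σ M j) - z) 1 * (fold (diamondPoint σ M (j + 1)) - z) 0) := by
  obtain ⟨k, h1, h2⟩ := exists_cell_diamondPoint hσ hM j
  have hM' : (0 : ℝ) < M := by positivity
  have hσσ : σ * σ = 1 := by rcases hσ with rfl | rfl <;> norm_num
  set a : ℝ := j / (2 * M) with ha
  have ha' : ((j + 1 : ℕ) : ℝ) / (2 * M) = a + 1 / (2 * M) := by
    rw [ha]; push_cast; field_simp
  set e : ℝ := 1 / (2 * M) with he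
  have hepos : 0 < e := by positivity
  have hsq : √2 * √2 = 2 := Real.mul_self_sqrt (by norm_num)
  have hzb : ∀ ρ : ℝ, ρ = 1 ∨ ρ = -1 → |z 0 - ρ * z 1| < 1 / 2 := fun ρ hρ => by
    refine (sub_sq_le_two_mul z hρ).trans_lt ?_
    have : √2 * ‖z‖ < √2 * (√2 / 4) := mul_lt_mul_of_pos_left hz (by positivity)
    linarith
  have hz1 := abs_lt.1 (hzb 1 (Or.inl rfl))
  have hz2 := abs_lt.1 (hzb (-1) (Or.inr rfl))
  rw [fold_eq_cellMap h1, fold_eq_cellMap h2]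
  have b0 := abs_le.1 (h1 0)
  have b1 := abs_le.1 (h1 1)
  simp only [PiLp.sub_apply, cellMap_apply, flip_apply, center_apply, diamondPoint_zero,
    diamondPoint_one, ha'] at b0 b1 ⊢
  rw [← ha] at b0 b1 ⊢
  -- Up to the sign `σ` the motion is along a staircase of cells, so the two indices agree or differ
  -- by one. These alternatives and the parity of `k 1` give the four sides of the diamond, and the
  -- cross product is positive because the disc of radius `√2 / 4` is inscribed in it.
  have hdiff : ∃ m : ℤ, k 0 = (if σ = 1 then 1 else -1) * (k 1 + m) ∧ (m = 0 ∨ m = 1) := by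
    rcases hσ with rfl | rfl
    · refine ⟨k 0 - k 1, by simp, ?_⟩
      have c1 : (-1 : ℝ) < k 0 - k 1 := by linarith
      have c2 : (k 0 : ℝ) - k 1 < 2 := by linarith
      have c1' : (-1 : ℤ) < k 0 - k 1 := by exact_mod_cast c1
      have c2' : k 0 - k 1 < 2 := by exact_mod_cast c2
      omega
    · refine ⟨-k 0 - k 1, by norm_num, ?_⟩
      have c1 : (-1 : ℝ) < -k 0 - k 1 := by linarith
      have c2 : -(k 0 : ℝ) - k 1 < 2 := by linarith
      have c1' : (-1 : ℤ) < -k 0 - k 1 := by exact_mod_cast c1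
      have c2' : -k 0 - k 1 < 2 := by exact_mod_cast c2
      omega
  obtain ⟨m, hm, hm01⟩ := hdiff
  have hk0 : (k 0 : ℝ) = σ * (k 1 + m) := by
    rw [hm]; rcases hσ with rfl | rfl
    · push_cast; simp
    · push_cast; norm_num
  have hsign : sign (k 0) = sign (k 1 + m) := by
    rw [hm]
    rcases hσ with rfl | rfl
    · simp
    · norm_num
      have h5 : -m + -k 1 = -(k 1 + m) := by ring
      rw [h5, sign_neg]
  have hs1 : sign (k 1) = 1 ∨ sign (k 1) = -1 := by
    rw [sign]; split_ifs <;> simp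
  have hgoal : ∀ s0 s1 : ℝ, s1 * s1 = 1 → s0 * s0 = 1 →
      σ * ((s0 * (σ * a - k 0) - z 0) * (s1 * (-(1 / 2) + (a + e) - k 1) - z 1) -
      (s1 * (-(1 / 2) + a - k 1) - z 1) * (s0 * (σ * (a + e) - k 0) - z 0)) =
      e * (s0 * s1 * (1 / 2 - m) - σ * s1 * z 0 + s0 * z 1) := by
    intro s0 s1 _ _
    rw [hk0]
    linear_combination (e * s0 * z 1 + e * s0 * s1 * (1 / 2 - m)) * hσσ
  rw [hgoal _ _ (sign_mul_self _) (sign_mul_self _)]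
  refine mul_pos hepos ?_
  rw [hsign]
  rcases hm01 with rfl | rfl
  · rw [add_zero]
    rcases hσ with rfl | rfl <;> rcases hs1 with h | h <;> rw [h] <;> norm_num <;> linarith
  · rw [sign_succ]
    rcases hσ with rfl | rfl <;> rcases hs1 with h | h <;> rw [h] <;> norm_num <;> linarith

/-- The state at the midpoint of the lower side with direction `θ`. -/
noncomputable def bottomState (hr : O ⊆ Metric.closedBall 0 r) (hr' : r < √2 / 4) (θ : ℝ) :
    State (copies O) where
  pos := bottom
  vel := !₂[Real.cos θ, Real.sin θ]
  free k hk := free_of_forall_lt_norm hr (lt_norm_bottom_sub_center hr') k (interior_subset hk)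
  norm_eq := by simp [EuclideanSpace.norm_eq]

theorem orbit_bottomState (hC : IsScatterer (copies O) τ) (hr : O ⊆ Metric.closedBall 0 r)
    (hr' : r < √2 / 4) {σ : ℝ} (hσ : σ = 1 ∨ σ = -1) {M : ℕ} (hτ : τ = √2 / 2 / M)
    {θ : ℝ} (hcos : Real.cos θ = σ * (√2 / 2)) (hsin : Real.sin θ = √2 / 2) (j : ℕ) :
    (orbit hC (bottomState hr hr' θ) j).pos = diamondPoint σ M j := by
  have hsq : √2 * √2 = 2 := Real.mul_self_sqrt (by norm_num)
  have hσσ : σ * σ = 1 := by rcases hσ with rfl | rfl <;> norm_num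
  rw [(orbit_eq_of_forall_notMem hC (bottomState hr hr' θ) (fun t _ =>
    free_of_forall_lt_norm hr (lt_norm_sub_center hr' hσ ?_)) j).1]
  · have e : (j : ℝ) * (√2 / 2 / M) * (√2 / 2) = j / (2 * M) := by
      rw [show (j : ℝ) * (√2 / 2 / M) * (√2 / 2) = j * (√2 * √2) / (4 * M) by ring, hsq]
      rw [show (4 : ℝ) * M = 2 * (2 * M) by ring, mul_comm (j : ℝ) 2,
        mul_div_mul_left _ _ two_ne_zero]
    ext i
    fin_cases i
    · simp only [Fin.zero_eta, diamondPoint_zero]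
      simp [bottomState, bottom, hcos, hτ]
      linear_combination σ * e
    · simp only [Fin.mk_one, diamondPoint_one]
      simp [bottomState, bottom, hsin, hτ]
      linear_combination e
  · simp [bottomState, bottom, hcos, hsin]; ring

/-- The vector from `z` to the `j`-th point of the folded orbit of `x`. -/
noncomputable def orbitVector (hC : IsScatterer (copies O) τ) (x : State (copies O)) (z : Plane)
    (j : ℕ) : Plane := fold (orbit hC x j).pos - z

theorem fold_curve_sub (hC : IsScatterer (copies O) τ) (x : State (copies O)) (z : Plane)
    (j : ℕ) : fold (curve hC x (j * τ)) - z = orbitVector hC x z j := by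
  have := curve_eq_piece hC x j (u := 0) ⟨le_rfl, hC.pos.le⟩
  rw [add_zero, piece_zero] at this
  rw [this, orbitVector]

theorem norm_fold_curve_sub_le (hO : IsObstacle O) (hC : IsScatterer (copies O) τ)
    (x : State (copies O)) {s t : ℝ} (hs : 0 ≤ s) (hst : s ≤ t) (ht : 0 < t) :
    ‖fold (curve hC x t) - fold (curve hC x s)‖ ≤ t - s :=
  (isTrajectoryPiece_fold_curve hO hC x ht).norm_sub_le hs hst le_rfl

theorem lt_norm_orbitVector {z : Plane} (hfar : ∀ p ∉ interior O, τ < ‖p - z‖)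
    (hC : IsScatterer (copies O) τ) (x : State (copies O)) (j : ℕ) :
    τ < ‖orbitVector hC x z j‖ :=
  hfar _ (fold_notMem_interior (orbit hC x j).free)

theorem isDisplacement_angleSum_orbitVector {z : Plane} (hfar : ∀ p ∉ interior O, τ < ‖p - z‖)
    (hO : IsObstacle O) (hC : IsScatterer (copies O) τ)
    (x : State (copies O)) {N : ℕ} (hN : 0 < N) :
    IsDisplacement z (fun t => fold (curve hC x t)) (N * τ)
      (angleSum (orbitVector hC x z) N) := by
  have hτ := hC.pos
  have h := exists_isDisplacement_angleSum (z := z) hτ N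
    (isTrajectoryPiece_fold_curve hO hC x (T := N * τ) (by positivity)).continuousOn
    fun j _ t ht => by
      rw [fold_curve_sub]
      refine lt_of_le_of_lt ?_ (lt_norm_orbitVector hfar hC x j)
      rcases ht.1.eq_or_lt with h | h
      · rw [← h, sub_self, norm_zero]; exact hτ.le
      · refine (norm_fold_curve_sub_le hO hC x (by positivity) ht.1
          (lt_of_le_of_lt (by positivity) h)).trans ?_
        have := ht.2
        push_cast at this
        linarith
  simpa only [fold_curve_sub] using h

/-- Only positions at multiples of `τ` enter the sum, so the discontinuity of the velocities is
harmless; `hfar` keeps each quotient off the cut of the argument. -/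
theorem continuous_angleSum_orbitVector {z : Plane} (hfar : ∀ p ∉ interior O, τ < ‖p - z‖)
    (hO : IsObstacle O) (hC : IsScatterer (copies O) τ)
    {x : ℝ → State (copies O)} (hp : Continuous fun θ => (x θ).pos)
    (hv : Continuous fun θ => (x θ).vel) (N : ℕ) (S : Set ℝ) :
    ContinuousOn (fun θ => angleSum (orbitVector hC (x θ) z) N) S := by
  have hτ := hC.pos
  have hc : ∀ j, Continuous fun θ => orbitVector hC (x θ) z j := fun j =>
    (continuous_fold.comp (continuous_iterate_next_pos hC hp hv j)).sub continuous_const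
  unfold angleSum
  refine continuousOn_finsetSum _ fun j _ => ?_
  refine ContinuousOn.angleBetween (hc j).continuousOn (hc (j + 1)).continuousOn fun θ _ => ?_
  refine lt_of_le_of_lt ?_ (lt_norm_orbitVector hfar hC (x θ) j)
  rw [← fold_curve_sub, ← fold_curve_sub, sub_sub_sub_cancel_right]
  have h1 : (j : ℝ) * τ ≤ ((j + 1 : ℕ) : ℝ) * τ := by push_cast; linarith
  refine (norm_fold_curve_sub_le hO hC (x θ) (by positivity) h1 (by positivity)).trans ?_
  push_cast; linarith

theorem le_mul_angleSum_orbitVector {z : Plane} (hfar : ∀ p ∉ interior O, τ < ‖p - z‖)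
    (hC : IsScatterer (copies O) τ)
    (hr : O ⊆ Metric.closedBall 0 r) (hr' : r < √2 / 4) {σ : ℝ} (hσ : σ = 1 ∨ σ = -1) {M : ℕ}
    (hM : 0 < M) (hτ : τ = √2 / 2 / M) {θ : ℝ} (hcos : Real.cos θ = σ * (√2 / 2))
    (hsin : Real.sin θ = √2 / 2) (hz : ‖z‖ < √2 / 4) (n : ℕ) :
    n ≤ σ * angleSum (orbitVector hC (bottomState hr hr' θ) z) (n * (4 * M)) := by
  have hP : ∀ j, orbitVector hC (bottomState hr hr' θ) z j = fold (diamondPoint σ M j) - z :=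
    fun j => by rw [orbitVector, orbit_bottomState hC hr hr' hσ hτ hcos hsin j]
  refine le_mul_angleSum (by positivity) (fun j => ?_) (fun j h0 => ?_) hσ (fun j => ?_) n
  · rw [hP, hP, fold_diamondPoint_add hσ hM]
  · have := lt_norm_orbitVector hfar hC (bottomState hr hr' θ) j
    rw [h0, norm_zero] at this
    linarith [hC.pos]
  · rw [hP, hP]; exact cross_fold_diamondPoint hσ hM j hz

theorem exists_trajectory_of_speed (hO : IsObstacle O) (hconv : Convex ℝ O)
    (hr : O ⊆ Metric.closedBall 0 r) (hr' : r < √2 / 4) {z : Plane} (hz : z ∈ interior O)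
    {ρ : ℝ} (hρ : |ρ| ≤ √2 / 4) (n : ℕ) (hn : 0 < n) :
    ∃ γ, IsTrajectoryPiece O (2 * √2 * n) γ ∧
      IsDisplacement z γ (2 * √2 * n) (ρ * (2 * √2 * n)) := by
  have hsq : √2 * √2 = 2 := Real.mul_self_sqrt (by norm_num)
  have hs2 : √2 ≤ 3 / 2 := by rw [Real.sqrt_le_left (by norm_num)]; norm_num
  obtain ⟨ε, hε, hball⟩ := Metric.isOpen_iff.1 isOpen_interior z hz
  -- `M` steps make up a side of the diamond, of length `√2 / 2`. The bound `ε` keeps a step shorter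
  -- than the distance from `z` to the table; `1/4` ensures `τ + 2 * r < 1`.
  obtain ⟨M, hM⟩ := exists_nat_gt (√2 / 2 / min ε (1 / 4))
  have hmin : 0 < min ε (1 / 4) := lt_min hε (by norm_num)
  have hM' : (0 : ℝ) < M := lt_trans (by positivity) hM
  have hM0 : 0 < M := by exact_mod_cast hM'
  obtain ⟨τ, hτ⟩ : ∃ τ : ℝ, τ = √2 / 2 / M := ⟨_, rfl⟩
  have hτ0 : 0 < τ := by rw [hτ]; positivity
  have hτmin : τ < min ε (1 / 4) := by
    rw [hτ, div_lt_iff₀ hM', mul_comm]; rwa [div_lt_iff₀ hmin] at hM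
  have hC : IsScatterer (copies O) τ := isScatterer_copies hO hconv hr hτ0 (by
    linarith [hτmin.trans_le (min_le_right ε (1 / 4))])
  have hzn : ‖z‖ < √2 / 4 := (mem_closedBall_zero_iff.1 (hr (interior_subset hz))).trans_lt hr'
  have hT : (2 * √2 * n : ℝ) = ((n * (4 * M) : ℕ) : ℝ) * τ := by
    rw [hτ]; push_cast; field_simp; ring
  have hfar : ∀ p ∉ interior O, τ < ‖p - z‖ := fun p hp => by
    by_contra hcon
    push Not at hcon
    refine hp (hball ?_)
    rw [Metric.mem_ball, dist_eq_norm]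
    exact hcon.trans_lt (hτmin.trans_le (min_le_left _ _))
  have h1 := le_mul_angleSum_orbitVector hfar hC hr hr' (Or.inl rfl : (1 : ℝ) = 1 ∨ _) hM0 hτ
    (θ := Real.pi / 4) (by rw [one_mul, Real.cos_pi_div_four]) Real.sin_pi_div_four hzn n
  have h2 := le_mul_angleSum_orbitVector hfar hC hr hr'
    (Or.inr rfl : (-1 : ℝ) = 1 ∨ (-1 : ℝ) = -1) hM0 hτ (θ := Real.pi - Real.pi / 4)
    (by rw [Real.cos_pi_sub, Real.cos_pi_div_four]; ring)
    (by rw [Real.sin_pi_sub, Real.sin_pi_div_four]) hzn n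
  have hρT : |ρ * (2 * √2 * n)| ≤ n := by
    rw [abs_mul, abs_of_pos (by positivity : 0 < 2 * √2 * (n : ℝ))]
    calc |ρ| * (2 * √2 * n) ≤ √2 / 4 * (2 * √2 * n) :=
          mul_le_mul_of_nonneg_right hρ (by positivity)
      _ = n := by linear_combination (n : ℝ) / 2 * hsq
  rw [abs_le] at hρT
  have hvel : Continuous fun θ => (bottomState hr hr' θ).vel := by
    simp only [bottomState]; fun_prop
  have hD := continuous_angleSum_orbitVector hfar hO hC (x := bottomState hr hr')
    continuous_const hvel (n * (4 * M)) (Icc (Real.pi / 4) (Real.pi - Real.pi / 4))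
  -- The direction `π / 4` turns counterclockwise, `3 * π / 4` clockwise, so the larger value is at
  -- the left end of the interval.
  obtain ⟨θ, -, hθ⟩ := intermediate_value_Icc' (by linarith [Real.pi_pos]) hD
    (show ρ * (2 * √2 * n) ∈ Icc _ _ from ⟨by linarith, by linarith⟩)
  refine ⟨fun t => fold (curve hC (bottomState hr hr' θ) t), ?_, ?_⟩
  · exact isTrajectoryPiece_fold_curve hO hC _ (by positivity)
  · rw [← hθ, hT]
    exact isDisplacement_angleSum_orbitVector hfar hO hC _ (by positivity)

theorem subset_rotationSet (hO : IsObstacle O) (hconv : Convex ℝ O) (hsmall : IsSmall O)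
    {z : Plane} (hz : z ∈ interior O) : Icc (-(√2 / 4)) (√2 / 4) ⊆ rotationSet O z := by
  obtain ⟨r, hr', hr⟩ := hsmall
  intro ρ hρ
  choose γ h1 h2 using fun n : ℕ =>
    exists_trajectory_of_speed hO hconv hr hr' hz (abs_le.2 hρ) (n + 1) n.succ_pos
  refine ⟨γ, fun n => 2 * √2 * (n + 1 : ℕ), _, fun n => ⟨h1 n, h2 n⟩, ?_, ?_⟩
  · refine Tendsto.const_mul_atTop (by positivity) ?_
    exact tendsto_natCast_atTop_atTop.comp (tendsto_add_atTop_nat 1)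
  · refine tendsto_const_nhds.congr fun n => ?_
    rw [mul_div_cancel_right₀ _ (by positivity)]

end

end SquareBilliard

theorem mainTheorem5 (O : Set SquareBilliard.Plane) (hO : SquareBilliard.IsObstacle O)
    (z : SquareBilliard.Plane) (hz : z ∈ interior O) :
    SquareBilliard.rotationSet O z ⊆ Set.Icc (-(√2 / 4)) (√2 / 4) ∧
    (Convex ℝ O → SquareBilliard.IsSmall O →
      SquareBilliard.rotationSet O z = Set.Icc (-(√2 / 4)) (√2 / 4)) :=
  ⟨hO.rotationSet_subset hz, fun hconv hsmall =>
    (hO.rotationSet_subset hz).antisymm (SquareBilliard.subset_rotationSet hO hconv hsmall hz)⟩
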